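/- Let $(X,d)$ be a compact metric (or semi-metric) space, $m$ a Borel probability measure on $X$, and $\xi=\xi(x)$, $x\in X$, a real random field on a probability space $(\Omega,\mathbf P)$ which is jointly measurable, separable, continuous in probability and centred ($\mathbf E\,\xi(x)=0$). Put $$\phi(\lambda)=\log\sup_{x\in X}\mathbf E\,e^{\lambda\xi(x)}\in[0,\infty],\qquad \phi^*(u)=\sup_{\lambda\in\mathbb R}(\lambda u-\phi(\lambda)),\qquad \Phi(u)=e^{\phi^*(u)}-1,\quad \Phi^{-1}(w)=\sup\{z\ge 0:\Phi(z)\le w\}.$$ Assume that $\xi$ satisfies the uniform Cramér condition, i.e. $\phi$ is finite on some interval $(-\lambda_0,\lambda_0)$, $\lambda_0>0$, and that $\phi$ is even. Let $d_\Phi(x_1,x_2)=\inf\{k>0:\mathbf E\,\Phi(|\xi(x_1)-\xi(x_2)|/k)\le 1\}$ be the Orlicz norm of $\xi(x_1)-\xi(x_2)$, let $h_-(r)=\inf_{x}m\{y:d_\Phi(x,y)\le r\}$, and for $0\le V<\infty$ $$\overline w(x_1,x_2;V)=12\int_0^{d_\Phi(x_1,x_2)}\Phi^{-1}\!\left[\frac{4V}{h_-(r)^2}\right]dr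 .$$ Assume that $m$ is minorizing in the sense that $\overline w(x_1,x_2;V)<\infty$ for all $x_1,x_2\in X$ and $V<\infty$. Define $$\gamma(V)=\sup_{x_1,x_2\in X}\overline w(x_1,x_2;V),\qquad \zeta(x_1,x_2)=\sup_{Y>0}\frac{\overline w(x_1,x_2;Y)}{\gamma(Y)}\ \ (0/0:=0),\qquad D_\zeta=\sup_{x_1,x_2}\zeta(x_1,x_2),$$ $$Z=\int_X\!\int_X\Phi\!\left(\frac{|\xi(x_1)-\xi(x_2)|}{d_\Phi(x_1,x_2)}\right)m(dx_1)\,m(dx_2),\qquad \theta=\gamma(Z)$$ (the integrand in $Z$ is taken to be $0$ where $d_\Phi(x_1,x_2)=0$), and let $$K=\|\theta\|_{B(\phi)}=\left[\|\theta-\mathbf E\theta\|_{B(\phi)}^2+(\mathbf E\theta)^2\right]^{1/2},$$ where, for a centred random variable $\eta$, $\|\eta\|_{B(\phi)}=\inf\{\tau>0:\mathbf E\,e^{\lambda\eta}\le e^{\phi(\lambda\tau)}\ \text{for all }\lambda\in\mathbb R\}$. Let $N(X,\zeta,\delta)\in\{1,2,\dots,\infty\}$ be the minimal number of closed $\zeta$-balls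 of radius $\delta$ that cover $X$. Finally let $u_0=2K(1+K)/\mathbf E\theta$ ($u_0=0$ if $\theta=0$ almost surely). Then $K<\infty$, $u_0<\infty$, and for every $u\ge\max(2,u_0)$ $$\mathbf P\Big(\sup_{x\in X}\xi(x)>u\Big)\le\inf_{\delta\in(0,D_\zeta)}N(X,\zeta,\delta)\,\exp\!\left(-\phi^*\!\Big(\frac{u}{1+K\delta}\Big)\right),$$ $$\mathbf P\Big(\sup_{x\in X}|\xi(x)|>u\Big)\le 2\inf_{\delta\in(0,D_\zeta)}N(X,\zeta,\delta)\,\exp\!\left(-\phi^*\!\Big(\frac{u}{1+K\delta}\Big)\right),$$ where the infimum over the empty set is $+\infty$ and $\infty\cdot 0=0$. -/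

import Mathlib

open MeasureTheory Filter Topology
open scoped ENNReal

namespace RandomFieldSup

noncomputable section

/-- The natural function `φ(lam) = log sup_x E exp (lam ξ(x))`, with values in `[-∞, ∞]`. -/
def naturalFunction {X Ω : Type*} [MeasurableSpace Ω] (P : Measure Ω) (ξ : X → Ω → ℝ)
    (lam : ℝ) : EReal :=
  ENNReal.log (⨆ x : X, ∫⁻ ω, ENNReal.ofReal (Real.exp (lam * ξ x ω)) ∂P)

/-- The Young-Fenchel transform `φ^*(u) = sup_lam (lam u - φ(lam))`; arguments `lam` at which
`φ = ∞` do not contribute. -/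
def youngFenchel (φ : ℝ → EReal) (u : ℝ) : EReal :=
  ⨆ lam : ℝ, (((lam * u : ℝ) : EReal) - φ lam)

/-- The Young-Orlicz function `Φ(u) = exp (φ^*(u)) - 1`. -/
def youngOrlicz (φ : ℝ → EReal) (u : ℝ) : ℝ≥0∞ :=
  EReal.exp (youngFenchel φ u) - 1

/-- `Φ⁻¹(w) = sup {z ≥ 0 : Φ(z) ≤ w}`. -/
def orliczInv (Φ : ℝ → ℝ≥0∞) (w : ℝ≥0∞) : ℝ≥0∞ :=
  ⨆ (z : ℝ) (_ : 0 ≤ z) (_ : Φ z ≤ w), ENNReal.ofReal z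

/-- The (Luxemburg) Orlicz norm of a random variable. -/
def orliczNorm {Ω : Type*} [MeasurableSpace Ω] (P : Measure Ω) (Φ : ℝ → ℝ≥0∞)
    (η : Ω → ℝ) : ℝ≥0∞ :=
  ⨅ (k : ℝ) (_ : 0 < k) (_ : ∫⁻ ω, Φ (|η ω| / k) ∂P ≤ 1), ENNReal.ofReal k

/-- The natural distance `d_Φ(x₁, x₂) = ‖ξ(x₁) - ξ(x₂)‖_{L(Ω,Φ)}`. -/
def natDist {X Ω : Type*} [MeasurableSpace Ω] (P : Measure Ω) (Φ : ℝ → ℝ≥0∞)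
    (ξ : X → Ω → ℝ) (x₁ x₂ : X) : ℝ≥0∞ :=
  orliczNorm P Φ (fun ω => ξ x₁ ω - ξ x₂ ω)

/-- `h_-(r) = inf_x m(B(x,r))`, with closed balls of the distance `d`. -/
def minBall {X : Type*} [MeasurableSpace X] (m : Measure X) (d : X → X → ℝ≥0∞)
    (r : ℝ) : ℝ≥0∞ :=
  ⨅ x : X, m {y | d x y ≤ ENNReal.ofReal r}

/-- `w̄(x₁,x₂;V) = 12 ∫_0^{d(x₁,x₂)} Φ⁻¹ [4 V / h_-(r)²] dr`. -/
def wBar {X : Type*} [MeasurableSpace X] (m : Measure X) (d : X → X → ℝ≥0∞)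
    (Φ : ℝ → ℝ≥0∞) (x₁ x₂ : X) (V : ℝ≥0∞) : ℝ≥0∞ :=
  12 * ∫⁻ r in {r : ℝ | 0 < r ∧ ENNReal.ofReal r < d x₁ x₂},
    orliczInv Φ (4 * V / (minBall m d r) ^ 2)

/-- `γ(V) = sup_{x₁,x₂} w̄(x₁,x₂;V)`. -/
def gammaSup {X : Type*} [MeasurableSpace X] (m : Measure X) (d : X → X → ℝ≥0∞)
    (Φ : ℝ → ℝ≥0∞) (V : ℝ≥0∞) : ℝ≥0∞ :=
  ⨆ (x₁ : X) (x₂ : X), wBar m d Φ x₁ x₂ V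

/-- The semi-distance `ζ(x₁,x₂) = sup_{Y > 0} w̄(x₁,x₂;Y) / γ(Y)` (where `0/0 = 0`). -/
def zeta {X : Type*} [MeasurableSpace X] (m : Measure X) (d : X → X → ℝ≥0∞)
    (Φ : ℝ → ℝ≥0∞) (x₁ x₂ : X) : ℝ≥0∞ :=
  ⨆ (Y : ℝ) (_ : 0 < Y),
    wBar m d Φ x₁ x₂ (ENNReal.ofReal Y) / gammaSup m d Φ (ENNReal.ofReal Y)

/-- The diameter of the whole space for a distance function. -/
def diamOf {X : Type*} (d : X → X → ℝ≥0∞) : ℝ≥0∞ := ⨆ (x₁ : X) (x₂ : X), d x₁ x₂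

/-- `N(X,d,ε)`: the minimal number of closed `d`-balls of radius `ε` that cover the space. -/
def coverNumber {X : Type*} (d : X → X → ℝ≥0∞) (ε : ℝ) : ℕ∞ :=
  ⨅ (S : Set X) (_ : ∀ x, ∃ s ∈ S, d x s ≤ ENNReal.ofReal ε), S.encard

/-- `Z(ω) = ∫∫ Φ(|ξ(x₁,ω) - ξ(x₂,ω)| / d(x₁,x₂)) m(dx₁) m(dx₂)`; the integrand is `0` when
`d(x₁,x₂) = 0` (then `ξ(x₁) = ξ(x₂)` almost surely for the natural distance). -/
def zVar {X Ω : Type*} [MeasurableSpace X] (m : Measure X) (d : X → X → ℝ≥0∞)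
    (Φ : ℝ → ℝ≥0∞) (ξ : X → Ω → ℝ) (ω : Ω) : ℝ≥0∞ :=
  ∫⁻ x₁, ∫⁻ x₂, Φ (|ξ x₁ ω - ξ x₂ ω| / (d x₁ x₂).toReal) ∂m ∂m

/-- The `B(φ)` norm of a centred random variable `η`: the infimum of all `τ > 0` such that
`E exp (lam η) ≤ exp (φ(lam τ))` for every `lam`. -/
def bNorm {Ω : Type*} [MeasurableSpace Ω] (P : Measure Ω) (φ : ℝ → EReal)
    (η : Ω → ℝ) : ℝ≥0∞ :=
  ⨅ (τ : ℝ) (_ : 0 < τ)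
    (_ : ∀ lam : ℝ, ∫⁻ ω, ENNReal.ofReal (Real.exp (lam * η ω)) ∂P ≤ EReal.exp (φ (lam * τ))),
    ENNReal.ofReal τ

/-- The `B(φ)` norm of a non-negative, not necessarily centred, random variable `κ`:
`(‖κ - Eκ‖² + (Eκ)²)^{1/2}`. -/
def bNormNonneg {Ω : Type*} [MeasurableSpace Ω] (P : Measure Ω) (φ : ℝ → EReal)
    (κ : Ω → ℝ≥0∞) : ℝ≥0∞ :=
  ((bNorm P φ (fun ω => (κ ω).toReal - (∫⁻ ω', κ ω' ∂P).toReal)) ^ 2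
    + (∫⁻ ω', κ ω' ∂P) ^ 2) ^ (1 / 2 : ℝ)

/-- Separability of a random field: there is a countable set `S` such that almost surely every
point of the graph of the trajectory is a limit of points of the graph over `S`. -/
def IsSeparableField {X Ω : Type*} [TopologicalSpace X] [MeasurableSpace Ω] (P : Measure Ω)
    (ξ : X → Ω → ℝ) : Prop :=
  ∃ S : Set X, S.Countable ∧
    ∀ᵐ ω ∂P, ∀ x, (x, ξ x ω) ∈ closure ((fun s => (s, ξ s ω)) '' S)

/-- The uniform Cramér condition: the natural function is finite on a non-trivial interval. -/
def UniformCramer {X Ω : Type*} [MeasurableSpace Ω] (P : Measure Ω) (ξ : X → Ω → ℝ) : Prop :=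
  ∃ lam₀ : ℝ, 0 < lam₀ ∧ ∀ lam : ℝ, |lam| < lam₀ → naturalFunction P ξ lam < ⊤

/-- The Young-Orlicz function generated by the field, `Φ = exp (φ^*) - 1`. -/
def fieldPhi {X Ω : Type*} [MeasurableSpace Ω] (P : Measure Ω) (ξ : X → Ω → ℝ) : ℝ → ℝ≥0∞ :=
  youngOrlicz (naturalFunction P ξ)

/-- The natural distance generated by the field. -/
def fieldDist {X Ω : Type*} [MeasurableSpace Ω] (P : Measure Ω) (ξ : X → Ω → ℝ) :
    X → X → ℝ≥0∞ :=
  natDist P (fieldPhi P ξ) ξ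

/-- The function `w̄` of the field and of the measure `m`. -/
def fieldWBar {X Ω : Type*} [MeasurableSpace X] [MeasurableSpace Ω] (P : Measure Ω)
    (m : Measure X) (ξ : X → Ω → ℝ) : X → X → ℝ≥0∞ → ℝ≥0∞ :=
  wBar m (fieldDist P ξ) (fieldPhi P ξ)

/-- The semi-distance `ζ` of the field and of the measure `m`. -/
def fieldZeta {X Ω : Type*} [MeasurableSpace X] [MeasurableSpace Ω] (P : Measure Ω)
    (m : Measure X) (ξ : X → Ω → ℝ) : X → X → ℝ≥0∞ :=
  zeta m (fieldDist P ξ) (fieldPhi P ξ)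

/-- The random variable `θ = γ(Z)`. -/
def fieldTheta {X Ω : Type*} [MeasurableSpace X] [MeasurableSpace Ω] (P : Measure Ω)
    (m : Measure X) (ξ : X → Ω → ℝ) (ω : Ω) : ℝ≥0∞ :=
  gammaSup m (fieldDist P ξ) (fieldPhi P ξ) (zVar m (fieldDist P ξ) (fieldPhi P ξ) ξ ω)

/-- The constant `K = ‖θ‖_{B(φ)}`. -/
def fieldK {X Ω : Type*} [MeasurableSpace X] [MeasurableSpace Ω] (P : Measure Ω)
    (m : Measure X) (ξ : X → Ω → ℝ) : ℝ≥0∞ :=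
  bNormNonneg P (naturalFunction P ξ) (fieldTheta P m ξ)

/-- The explicit threshold `u₀ = 2 K (1 + K) / E θ` (`0` if `θ = 0` almost surely, when
`K = 0` too). -/
def fieldThreshold {X Ω : Type*} [MeasurableSpace X] [MeasurableSpace Ω] (P : Measure Ω)
    (m : Measure X) (ξ : X → Ω → ℝ) : ℝ≥0∞ :=
  2 * fieldK P m ξ * (1 + fieldK P m ξ) / ∫⁻ ω, fieldTheta P m ξ ω ∂P

/-- The right-hand side
`inf_{0 < δ < D_ζ} N(X,ζ,δ) exp (-φ^*(u / (1 + K δ)))`; it is `∞` if `D_ζ = 0`. -/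
def entropyBound {X Ω : Type*} [MeasurableSpace X] [MeasurableSpace Ω] (P : Measure Ω)
    (m : Measure X) (ξ : X → Ω → ℝ) (u : ℝ) : ℝ≥0∞ :=
  ⨅ (δ : ℝ) (_ : 0 < δ) (_ : ENNReal.ofReal δ < diamOf (fieldZeta P m ξ)),
    ((coverNumber (fieldZeta P m ξ) δ : ℕ∞) : ℝ≥0∞) *
      EReal.exp (-(youngFenchel (naturalFunction P ξ) (u / (1 + (fieldK P m ξ).toReal * δ))))

end

end RandomFieldSup

/-! On a ζ-ball of radius δ the field oscillates by at most δθ with one random variable θ. The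
supremum is therefore controlled by the variables ξ(t) + δθ over the centres t of a finite cover,
and each of these has a tail governed by φ* again.

The increment bound is Garsia-Rodemich-Rumsey chaining (`ofReal_abs_sub_le_wBar`,
`ae_ofReal_abs_sub_le_wBar`). One passes from x₁ to x₂ through averages over d-balls of radius R/2^n
around each point, R = d(x₁,x₂). Jensen's inequality bounds a link by a multiple of r
Φ⁻¹(Z/h_-(r)²), the geometric sum of the links is dominated by w̄(x₁,x₂;Z), and the definition of ζ
gives w̄(x₁,x₂;Z) ≤ ζ(x₁,x₂) γ(Z).

The variable θ = γ(Z) has finite B(φ) norm. Convexity of φ* and φ*(0) = 0 give Φ⁻¹(ab) ≤ Φ⁻¹(a) +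
Φ⁻¹(b) (`orliczInv_mul_le`), hence γ(Z) ≤ γ(1) + B Φ⁻¹(Z). With EZ ≤ 1 and Young's inequality this
yields E exp(lθ) ≤ 2 exp(lA) M(lB), where M = exp φ. After centring, a quadratic bound near 0 and
the lower bound M(l) ≥ 1 + σl² of a nondegenerate field turn this into domination by M(lτ)
(`exists_bound_gammaSup`).

For the tail, Hölder's inequality bounds the norm of ξ(t) + δ(θ - Eθ) by 1 + δτ for every τ
admissible for θ - Eθ, and Chernoff's bound gives the argument (u - δEθ)/(1 + δτ). The gap between K
and ‖θ - Eθ‖, created by the term (Eθ)² in K², pays for the shift δEθ as soon as u ≥ u₀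
(`lt_sub_div_of_threshold`, `div_le_div_of_lt_sub_div`). -/

namespace RandomFieldSup

/-! ### The moment function M = exp φ and its dual exp φ*. -/

/-- The real exponential with values in `ℝ≥0∞`. -/
noncomputable abbrev eexp (x : ℝ) : ℝ≥0∞ := ENNReal.ofReal (Real.exp x)

theorem eexp_add (x y : ℝ) : eexp (x + y) = eexp x * eexp y := by
  simp only [eexp, Real.exp_add, ENNReal.ofReal_mul (Real.exp_pos x).le]

theorem eexp_rpow (x t : ℝ) : eexp x ^ t = eexp (t * x) := by
  simp only [eexp, ENNReal.ofReal_rpow_of_pos (Real.exp_pos x), ← Real.exp_mul, mul_comm]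

theorem eexp_ne_zero (x : ℝ) : eexp x ≠ 0 := by simp [eexp, Real.exp_pos]

theorem eexp_ne_top (x : ℝ) : eexp x ≠ ⊤ := ENNReal.ofReal_ne_top

theorem eexp_mono {x y : ℝ} (h : x ≤ y) : eexp x ≤ eexp y :=
  ENNReal.ofReal_le_ofReal (Real.exp_le_exp.2 h)

theorem eexp_zero : eexp 0 = 1 := by simp [eexp]

theorem continuous_eexp : Continuous eexp :=
  ENNReal.continuous_ofReal.comp Real.continuous_exp

theorem measurable_eexp : Measurable eexp := continuous_eexp.measurable

theorem ofReal_one_add_le_eexp (x : ℝ) : ENNReal.ofReal (1 + x) ≤ eexp x :=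
  ENNReal.ofReal_le_ofReal (by linarith [Real.add_one_le_exp x])

/-- `exp (φ^*)` for `φ = log M`. -/
noncomputable def expDual (M : ℝ → ℝ≥0∞) (u : ℝ) : ℝ≥0∞ := ⨆ l : ℝ, eexp (l * u) / M l

/-- The Young-Orlicz function `exp (φ^*) - 1` for `φ = log M`. -/
noncomputable def dualOrlicz (M : ℝ → ℝ≥0∞) (u : ℝ) : ℝ≥0∞ := expDual M u - 1

theorem exp_youngFenchel_log (M : ℝ → ℝ≥0∞) (u : ℝ) :
    EReal.exp (youngFenchel (fun l => ENNReal.log (M l)) u) = expDual M u := by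
  rw [youngFenchel, ← EReal.expOrderIso_apply, OrderIso.map_iSup]
  refine iSup_congr fun l => ?_
  rw [EReal.expOrderIso_apply, sub_eq_add_neg, EReal.exp_add, EReal.exp_neg, ENNReal.exp_log,
    EReal.exp_coe, div_eq_mul_inv]

theorem youngOrlicz_log (M : ℝ → ℝ≥0∞) :
    youngOrlicz (fun l => ENNReal.log (M l)) = dualOrlicz M := by
  funext u
  rw [youngOrlicz, exp_youngFenchel_log, dualOrlicz]

/-- The properties of `M = exp φ` for the natural function `φ` of a centred field which satisfies
the uniform Cramér condition and whose natural function is even. -/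
structure IsMoment (M : ℝ → ℝ≥0∞) : Prop where
  one_le : ∀ l, 1 ≤ M l
  map_zero : M 0 = 1
  even : ∀ l, M (-l) = M l
  -- φ(tl) ≤ tφ(l): convexity of φ enters only in this star-shaped form.
  map_mul_le : ∀ t l, 0 ≤ t → t ≤ 1 → M (t * l) ≤ M l ^ t
  quad : ∃ L C : ℝ, 0 < L ∧ 0 ≤ C ∧ ∀ l, |l| ≤ L → M l ≤ ENNReal.ofReal (1 + C * l ^ 2)

namespace IsMoment

variable {M : ℝ → ℝ≥0∞} (hM : IsMoment M)
include hM

theorem ne_zero (l : ℝ) : M l ≠ 0 := (zero_lt_one.trans_le (hM.one_le l)).ne'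

theorem map_abs (l : ℝ) : M |l| = M l := by
  rcases abs_choice l with h | h <;> rw [h]
  exact hM.even l

theorem exists_lt_top : ∃ L : ℝ, 0 < L ∧ M L < ⊤ := by
  obtain ⟨L, C, hL, hC, h⟩ := hM.quad
  exact ⟨L, hL, (h L (abs_of_pos hL).le).trans_lt ENNReal.ofReal_lt_top⟩

theorem mono {l k : ℝ} (h : |l| ≤ |k|) : M l ≤ M k := by
  rcases (abs_nonneg k).eq_or_lt with hk | hk
  · have hl : |l| = |k| := le_antisymm h (by rw [← hk]; exact abs_nonneg l)
    rw [← hM.map_abs l, hl, hM.map_abs]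
  · have h1 : |l| / |k| ≤ 1 := (div_le_one hk).2 h
    have h2 := hM.map_mul_le (|l| / |k|) |k| (by positivity) h1
    rw [div_mul_cancel₀ _ hk.ne', hM.map_abs, hM.map_abs] at h2
    refine h2.trans ?_
    calc M k ^ (|l| / |k|) ≤ M k ^ (1 : ℝ) := ENNReal.rpow_le_rpow_of_exponent_le (hM.one_le k) h1
      _ = M k := ENNReal.rpow_one _

theorem one_le_expDual (u : ℝ) : 1 ≤ expDual M u := by
  refine le_trans ?_ (le_iSup _ (0 : ℝ))
  simp [hM.map_zero]

/-- Young's inequality lz ≤ φ(l) + φ*(z), exponentiated. It survives M l = ⊤ because the dual is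
never 0. -/
theorem eexp_le (l z : ℝ) : eexp (l * z) ≤ M l * expDual M z := by
  have h : eexp (l * z) / M l ≤ expDual M z := le_iSup (fun l : ℝ => eexp (l * z) / M l) l
  rw [ENNReal.div_le_iff_le_mul (Or.inl (hM.ne_zero l))
    (Or.inr (zero_lt_one.trans_le (hM.one_le_expDual z)).ne')] at h
  rwa [mul_comm (M l)]

/-- Since φ is even, a negative l never beats |l| when u ≥ 0. -/
theorem expDual_le {u : ℝ} (hu : 0 ≤ u) {w : ℝ≥0∞} (h : ∀ l, 0 ≤ l → eexp (l * u) ≤ M l * w) :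
    expDual M u ≤ w := by
  refine iSup_le fun l => ENNReal.div_le_of_le_mul ?_
  refine (eexp_mono (mul_le_mul_of_nonneg_right (le_abs_self l) hu)).trans ?_
  rw [← hM.map_abs l, mul_comm w]
  exact h _ (abs_nonneg l)

theorem expDual_zero : expDual M 0 = 1 :=
  le_antisymm (hM.expDual_le le_rfl fun l _ => by simpa [eexp] using hM.one_le l) (hM.one_le_expDual 0)

theorem expDual_mono {u v : ℝ} (hu : 0 ≤ u) (h : u ≤ v) : expDual M u ≤ expDual M v :=
  hM.expDual_le hu fun l hl => (eexp_mono (mul_le_mul_of_nonneg_left h hl)).trans (hM.eexp_le l v)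

theorem expDual_convex {a b u v : ℝ} (ha : 0 ≤ a) (hb : 0 ≤ b) (hab : a + b = 1) :
    expDual M (a * u + b * v) ≤ ENNReal.ofReal a * expDual M u + ENNReal.ofReal b * expDual M v := by
  refine iSup_le fun l => ENNReal.div_le_of_le_mul ?_
  have h1 : Real.exp (l * (a * u + b * v)) ≤ a * Real.exp (l * u) + b * Real.exp (l * v) := by
    have := convexOn_exp.2 (Set.mem_univ (l * u)) (Set.mem_univ (l * v)) ha hb hab
    simp only [smul_eq_mul] at this
    rwa [show l * (a * u + b * v) = a * (l * u) + b * (l * v) by ring]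
  calc eexp (l * (a * u + b * v))
      ≤ ENNReal.ofReal (a * Real.exp (l * u) + b * Real.exp (l * v)) := ENNReal.ofReal_le_ofReal h1
    _ = ENNReal.ofReal a * eexp (l * u) + ENNReal.ofReal b * eexp (l * v) := by
        rw [ENNReal.ofReal_add (by positivity) (by positivity), ENNReal.ofReal_mul ha,
          ENNReal.ofReal_mul hb]
    _ ≤ ENNReal.ofReal a * (M l * expDual M u) + ENNReal.ofReal b * (M l * expDual M v) := by
        gcongr <;> exact hM.eexp_le _ _
    _ = _ := by ring

/-- The star-shaped form of the convexity of φ*: raise Young's inequality to the power t and use M ≥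
1. -/
theorem expDual_mul_le {t z : ℝ} (ht : 0 ≤ t) (ht1 : t ≤ 1) :
    expDual M (t * z) ≤ expDual M z ^ t := by
  refine iSup_le fun l => ENNReal.div_le_of_le_mul ?_
  calc eexp (l * (t * z)) = eexp (l * z) ^ t := by rw [eexp_rpow]; congr 1; ring
    _ ≤ (M l * expDual M z) ^ t := ENNReal.rpow_le_rpow (hM.eexp_le l z) ht
    _ = expDual M z ^ t * M l ^ t := by rw [ENNReal.mul_rpow_of_nonneg _ _ ht, mul_comm]
    _ ≤ expDual M z ^ t * M l := by
        gcongr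
        calc M l ^ t ≤ M l ^ (1 : ℝ) := ENNReal.rpow_le_rpow_of_exponent_le (hM.one_le l) ht1
          _ = M l := ENNReal.rpow_one _

theorem lowerSemicontinuous_expDual : LowerSemicontinuous (expDual M) :=
  lowerSemicontinuous_iSup fun l => Continuous.lowerSemicontinuous <|
    (ENNReal.continuous_div_const _ (hM.ne_zero l)).comp
      (continuous_eexp.comp (continuous_const.mul continuous_id))

theorem measurable_expDual : Measurable (expDual M) := hM.lowerSemicontinuous_expDual.measurable

theorem measurable_dualOrlicz : Measurable (dualOrlicz M) := hM.measurable_expDual.sub_const 1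

/-- Left continuity along rays, valid because the dual is a supremum of continuous functions. It
makes the infimum in the Luxemburg norm attained. -/
theorem expDual_le_of_forall_lt {z : ℝ} {w : ℝ≥0∞}
    (h : ∀ t, 0 < t → t < 1 → expDual M (t * z) ≤ w) : expDual M z ≤ w := by
  refine iSup_le fun l => ?_
  have hc : Tendsto (fun t : ℝ => eexp (l * (t * z)) / M l) (𝓝[<] 1) (𝓝 (eexp (l * (1 * z)) / M l)) := by
    refine (Continuous.tendsto ?_ 1).mono_left nhdsWithin_le_nhds
    exact (ENNReal.continuous_div_const _ (hM.ne_zero l)).comp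
      (continuous_eexp.comp (by fun_prop))
  rw [one_mul] at hc
  refine le_of_tendsto hc ?_
  filter_upwards [Ioo_mem_nhdsLT (zero_lt_one : (0 : ℝ) < 1)] with t ht
  exact (le_iSup (fun l : ℝ => eexp (l * (t * z)) / M l) l).trans (h t ht.1 ht.2)

theorem dualOrlicz_add_one (z : ℝ) : dualOrlicz M z + 1 = expDual M z :=
  tsub_add_cancel_of_le (hM.one_le_expDual z)

theorem dualOrlicz_zero : dualOrlicz M 0 = 0 := by simp [dualOrlicz, hM.expDual_zero]

theorem dualOrlicz_mono {u v : ℝ} (hu : 0 ≤ u) (h : u ≤ v) : dualOrlicz M u ≤ dualOrlicz M v :=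
  tsub_le_tsub_right (hM.expDual_mono hu h) 1

end IsMoment

/-! ### The generalised inverse of Φ and Jensen's inequality. -/

theorem dualOrlicz_le_iff {M : ℝ → ℝ≥0∞} {z : ℝ} {w : ℝ≥0∞} :
    dualOrlicz M z ≤ w ↔ expDual M z ≤ w + 1 := tsub_le_iff_right

theorem ofReal_le_orliczInv {Φ : ℝ → ℝ≥0∞} {z : ℝ} {w : ℝ≥0∞} (hz : 0 ≤ z) (h : Φ z ≤ w) :
    ENNReal.ofReal z ≤ orliczInv Φ w :=
  le_iSup_of_le z (le_iSup_of_le hz (le_iSup_of_le h le_rfl))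

theorem orliczInv_mono (Φ : ℝ → ℝ≥0∞) : Monotone (orliczInv Φ) := fun _ _ h =>
  iSup_le fun _ => iSup_le fun hz => iSup_le fun hw => ofReal_le_orliczInv hz (hw.trans h)

theorem lt_of_orliczInv_lt {Φ : ℝ → ℝ≥0∞} {z : ℝ} {w : ℝ≥0∞} (hz : 0 ≤ z)
    (h : orliczInv Φ w < ENNReal.ofReal z) : w < Φ z :=
  lt_of_not_ge fun hle => (ofReal_le_orliczInv hz hle).not_gt h

theorem orliczInv_top (Φ : ℝ → ℝ≥0∞) : orliczInv Φ ⊤ = ⊤ := by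
  refine ENNReal.eq_top_of_forall_nnreal_le fun r => ?_
  rw [← ENNReal.ofReal_coe_nnreal]
  exact ofReal_le_orliczInv r.2 le_top

/-- Jensen's inequality for the exponential function. -/
theorem eexp_integral_le {α : Type*} [MeasurableSpace α] {μ : Measure α} [IsProbabilityMeasure μ]
    {s : α → ℝ} (hs : AEMeasurable s μ) (hs0 : ∀ a, 0 ≤ s a) {t l : ℝ} (ht : 0 ≤ t) (hl : 0 ≤ l)
    (h : ∫⁻ a, ENNReal.ofReal (s a) ∂μ = ENNReal.ofReal t) :
    eexp (l * t) ≤ ∫⁻ a, eexp (l * s a) ∂μ := by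
  -- The tangent line of exp at lt, with its negative term moved to the other side so that no
  -- subtraction occurs in `ℝ≥0∞`.
  have key : ∀ a, eexp (l * t) * (1 + ENNReal.ofReal l * ENNReal.ofReal (s a))
      ≤ eexp (l * s a) + eexp (l * t) * ENNReal.ofReal (l * t) := fun a => by
    have hb : 0 ≤ l * s a := mul_nonneg hl (hs0 a)
    have ha : 0 ≤ l * t := mul_nonneg hl ht
    rw [← ENNReal.ofReal_mul hl, ← ENNReal.ofReal_one, ← ENNReal.ofReal_add zero_le_one hb,
      ← ENNReal.ofReal_mul (Real.exp_pos _).le, ← ENNReal.ofReal_mul (Real.exp_pos _).le,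
      ← ENNReal.ofReal_add (Real.exp_pos _).le (by positivity)]
    refine ENNReal.ofReal_le_ofReal ?_
    have h1 := Real.add_one_le_exp (l * s a - l * t)
    have h2 : Real.exp (l * s a) = Real.exp (l * t) * Real.exp (l * s a - l * t) := by
      rw [← Real.exp_add]; ring_nf
    rw [h2]
    nlinarith [Real.exp_pos (l * t)]
  have h1 := lintegral_mono (μ := μ) key
  rw [lintegral_const_mul'' _ ((hs.ennreal_ofReal.const_mul _).const_add _),
    lintegral_add_left measurable_const, lintegral_add_right' _ aemeasurable_const,
    lintegral_const_mul'' _ hs.ennreal_ofReal, h, ← ENNReal.ofReal_mul hl, lintegral_const,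
    lintegral_const, measure_univ, mul_one, mul_one, mul_add, mul_one] at h1
  exact (ENNReal.add_le_add_iff_right
    (ENNReal.mul_ne_top (eexp_ne_top _) ENNReal.ofReal_ne_top)).1 h1

namespace IsMoment

variable {M : ℝ → ℝ≥0∞} (hM : IsMoment M)
include hM

/-- If Φ(z) = 0 then 1 + lz ≤ M(l) ≤ 1 + Cl² for small l > 0, so z ≤ Cl → 0. This handles Z = 0, a
value outside the supremum over Y > 0 in ζ. -/
theorem orliczInv_zero : orliczInv (dualOrlicz M) 0 = 0 := by
  obtain ⟨L, C, hL, hC, h⟩ := hM.quad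
  refine le_antisymm (iSup_le fun z => iSup_le fun hz => iSup_le fun hw => ?_) zero_le
  rw [dualOrlicz_le_iff, zero_add] at hw
  rw [nonpos_iff_eq_zero, ENNReal.ofReal_eq_zero]
  have key : ∀ l, 0 < l → l ≤ L → z ≤ C * l := fun l hl hlL => by
    have h1 : ENNReal.ofReal (1 + l * z) ≤ ENNReal.ofReal (1 + C * l ^ 2) :=
      calc _ ≤ eexp (l * z) := ofReal_one_add_le_eexp _
        _ ≤ M l * expDual M z := hM.eexp_le l z
        _ ≤ M l * 1 := by gcongr
        _ ≤ _ := by rw [mul_one]; exact h l (by rwa [abs_of_pos hl])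
    rw [ENNReal.ofReal_le_ofReal_iff (by positivity)] at h1
    refine le_of_mul_le_mul_left (a := l) ?_ hl
    nlinarith
  have hc : Tendsto (fun l : ℝ => C * l) (𝓝[>] 0) (𝓝 (C * 0)) :=
    (Continuous.tendsto (by fun_prop) 0).mono_left nhdsWithin_le_nhds
  rw [mul_zero] at hc
  refine ge_of_tendsto hc ?_
  filter_upwards [Ioc_mem_nhdsGT hL] with l hl using key l hl.1 hl.2

/-- Young's inequality at z = Φ⁻¹(w), where exp φ* is at most w + 1. It converts EZ ≤ 1 into
exponential moments of Φ⁻¹(Z). -/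
theorem eexp_mul_orliczInv_le {l : ℝ} (hl : 0 ≤ l) (w : ℝ≥0∞) :
    eexp (l * (orliczInv (dualOrlicz M) w).toReal) ≤ M l * (w + 1) := by
  by_cases hR : M l * (w + 1) = ⊤
  · rw [hR]; exact le_top
  rcases hl.eq_or_lt with rfl | hl
  · rw [zero_mul, eexp_zero, hM.map_zero, one_mul]
    exact le_add_self
  have hpos : 0 < (M l * (w + 1)).toReal := by
    refine ENNReal.toReal_pos (mul_ne_zero (hM.ne_zero l) (by simp)) hR
  have hb : orliczInv (dualOrlicz M) w ≤ ENNReal.ofReal (Real.log (M l * (w + 1)).toReal / l) := by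
    refine iSup_le fun z => iSup_le fun hz => iSup_le fun hw => ENNReal.ofReal_le_ofReal ?_
    rw [dualOrlicz_le_iff] at hw
    rw [le_div_iff₀ hl, Real.le_log_iff_exp_le hpos, ← ENNReal.ofReal_le_iff_le_toReal hR,
      mul_comm z]
    exact (hM.eexp_le l z).trans (by gcongr)
  have h1 : 0 ≤ Real.log (M l * (w + 1)).toReal / l := by
    refine div_nonneg (Real.log_nonneg ?_) hl.le
    rw [← ENNReal.toReal_one]
    refine ENNReal.toReal_mono hR ?_
    calc (1 : ℝ≥0∞) = 1 * 1 := (mul_one 1).symm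
      _ ≤ _ := mul_le_mul' (hM.one_le l) le_add_self
  have h2 := ENNReal.toReal_le_of_le_ofReal h1 hb
  rw [le_div_iff₀ hl, Real.le_log_iff_exp_le hpos] at h2
  rw [← ENNReal.ofReal_toReal hR, mul_comm]
  exact ENNReal.ofReal_le_ofReal h2

theorem orliczInv_lt_top {w : ℝ≥0∞} (hw : w ≠ ⊤) : orliczInv (dualOrlicz M) w < ⊤ := by
  obtain ⟨l, hl, hMl⟩ := hM.exists_lt_top
  refine lt_of_le_of_lt (b := ENNReal.ofReal (((M l) * (w + 1)).toReal / l)) ?_ ENNReal.ofReal_lt_top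
  refine iSup_le fun z => iSup_le fun hz => iSup_le fun h => ENNReal.ofReal_le_ofReal ?_
  rw [dualOrlicz_le_iff] at h
  have hR : M l * (w + 1) ≠ ⊤ := ENNReal.mul_ne_top hMl.ne (by simp [hw])
  rw [le_div_iff₀ hl, ← ENNReal.ofReal_le_iff_le_toReal hR, mul_comm z]
  refine le_trans ?_ ((hM.eexp_le l z).trans (mul_le_mul_right h _))
  exact ENNReal.ofReal_le_ofReal (by linarith [Real.add_one_le_exp (l * z)])

/-- φ* is superadditive on the half-line, so exp φ*(p) exp φ*(q) ≤ exp φ*(p + q), while ab + 1 ≤ (a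
+ 1)(b + 1). -/
theorem orliczInv_mul_le (a b : ℝ≥0∞) : orliczInv (dualOrlicz M) (a * b) ≤
    orliczInv (dualOrlicz M) a + orliczInv (dualOrlicz M) b := by
  rcases eq_or_ne a ⊤ with rfl | ha
  · rw [orliczInv_top]; simp
  rcases eq_or_ne b ⊤ with rfl | hb
  · rw [orliczInv_top]; simp
  refine iSup_le fun z => iSup_le fun hz => iSup_le fun hw => ?_
  rw [dualOrlicz_le_iff] at hw
  by_contra! hlt
  have hpt := (hM.orliczInv_lt_top ha).ne
  have hqt := (hM.orliczInv_lt_top hb).ne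
  set p := (orliczInv (dualOrlicz M) a).toReal with hp
  set q := (orliczInv (dualOrlicz M) b).toReal with hq
  have hp0 : 0 ≤ p := ENNReal.toReal_nonneg
  have hq0 : 0 ≤ q := ENNReal.toReal_nonneg
  rw [← ENNReal.ofReal_toReal hpt, ← ENNReal.ofReal_toReal hqt, ← ENNReal.ofReal_add hp0 hq0,
    ENNReal.ofReal_lt_ofReal_iff_of_nonneg (by positivity)] at hlt
  have hz0 : 0 < z := by linarith
  obtain ⟨p', q', hp', hq', rfl⟩ : ∃ p' q' : ℝ, p < p' ∧ q < q' ∧ p' + q' = z :=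
    ⟨p + (z - p - q) / 2, q + (z - p - q) / 2, by linarith, by linarith, by ring⟩
  have h1 : a + 1 < expDual M p' := by
    have := lt_of_orliczInv_lt (Φ := dualOrlicz M) (z := p') (w := a) (by linarith)
      (by rw [← ENNReal.ofReal_toReal hpt]
          exact (ENNReal.ofReal_lt_ofReal_iff_of_nonneg hp0).2 hp')
    rwa [dualOrlicz, lt_tsub_iff_right] at this
  have h2 : b + 1 < expDual M q' := by
    have := lt_of_orliczInv_lt (Φ := dualOrlicz M) (z := q') (w := b) (by linarith)
      (by rw [← ENNReal.ofReal_toReal hqt]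
          exact (ENNReal.ofReal_lt_ofReal_iff_of_nonneg hq0).2 hq')
    rwa [dualOrlicz, lt_tsub_iff_right] at this
  set z := p' + q'
  have h3 := hM.expDual_mul_le (t := p' / z) (z := z) (div_nonneg (by linarith) hz0.le)
    ((div_le_one hz0).2 (by linarith))
  have h4 := hM.expDual_mul_le (t := q' / z) (z := z) (div_nonneg (by linarith) hz0.le)
    ((div_le_one hz0).2 (by linarith))
  rw [div_mul_cancel₀ _ hz0.ne'] at h3 h4
  have h5 : expDual M z ^ (p' / z) * expDual M z ^ (q' / z) = expDual M z := by
    rw [← ENNReal.rpow_add_of_nonneg _ _ (div_nonneg (by linarith) hz0.le)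
      (div_nonneg (by linarith) hz0.le),
      ← add_div, div_self hz0.ne', ENNReal.rpow_one]
  have h6 : (a + 1) * (b + 1) < expDual M p' * expDual M q' := ENNReal.mul_lt_mul h1 h2
  have h7 : a * b + 1 ≤ (a + 1) * (b + 1) := by
    calc a * b + 1 ≤ a * b + 1 + (a + b) := le_self_add
      _ = _ := by ring
  exact absurd (h6.trans_le ((mul_le_mul' h3 h4).trans (h5.le.trans (hw.trans h7)))) (lt_irrefl _)

/-- Jensen's inequality for the Young-Orlicz function. -/
theorem lintegral_le_orliczInv {α : Type*} [MeasurableSpace α] {μ : Measure α}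
    [IsProbabilityMeasure μ] {s : α → ℝ} (hs : AEMeasurable s μ) (hs0 : ∀ a, 0 ≤ s a) {W : ℝ≥0∞}
    (h : ∫⁻ a, dualOrlicz M (s a) ∂μ ≤ W) :
    ∫⁻ a, ENNReal.ofReal (s a) ∂μ ≤ orliczInv (dualOrlicz M) W := by
  rcases eq_or_ne W ⊤ with rfl | hW
  · rw [orliczInv_top]; exact le_top
  have hG : ∫⁻ a, expDual M (s a) ∂μ ≤ W + 1 := by
    calc ∫⁻ a, expDual M (s a) ∂μ = ∫⁻ a, (dualOrlicz M (s a) + 1) ∂μ := by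
          simp only [hM.dualOrlicz_add_one]
      _ = ∫⁻ a, dualOrlicz M (s a) ∂μ + 1 := by
          rw [lintegral_add_right _ measurable_const]; simp
      _ ≤ W + 1 := by gcongr
  -- As exp φ* is a supremum of scaled exponentials, it is enough to apply Jensen's inequality to
  -- each exponential.
  have hE : ∀ l, ∫⁻ a, eexp (l * s a) ∂μ ≤ M l * (W + 1) := fun l =>
    calc ∫⁻ a, eexp (l * s a) ∂μ ≤ ∫⁻ a, M l * expDual M (s a) ∂μ :=
          lintegral_mono fun a => hM.eexp_le l (s a)
      _ = M l * ∫⁻ a, expDual M (s a) ∂μ :=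
          lintegral_const_mul'' _ (hM.measurable_expDual.comp_aemeasurable hs)
      _ ≤ _ := by gcongr
  have hfin : ∫⁻ a, ENNReal.ofReal (s a) ∂μ ≠ ⊤ := by
    obtain ⟨L, hL, hML⟩ := hM.exists_lt_top
    have h1 : ENNReal.ofReal L * ∫⁻ a, ENNReal.ofReal (s a) ∂μ ≤ M L * (W + 1) := by
      rw [← lintegral_const_mul'' _ hs.ennreal_ofReal]
      refine le_trans (lintegral_mono fun a => ?_) (hE L)
      rw [← ENNReal.ofReal_mul hL.le]
      exact ENNReal.ofReal_le_ofReal (by linarith [Real.add_one_le_exp (L * s a)])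
    intro h2
    rw [h2, ENNReal.mul_top (by simpa using hL), top_le_iff] at h1
    exact ENNReal.mul_ne_top hML.ne (by simp [hW]) h1
  rw [← ENNReal.ofReal_toReal hfin]
  refine ofReal_le_orliczInv ENNReal.toReal_nonneg (dualOrlicz_le_iff.2 ?_)
  refine hM.expDual_le ENNReal.toReal_nonneg fun l hl => ?_
  exact (eexp_integral_le hs hs0 ENNReal.toReal_nonneg hl
    (ENNReal.ofReal_toReal hfin).symm).trans (hE l)

end IsMoment

/-! ### Moment bounds for the field. -/

/-- The function `sup_x E exp (l ξ(x))`. -/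
noncomputable def momentSup {X Ω : Type*} [MeasurableSpace Ω] (P : Measure Ω) (ξ : X → Ω → ℝ)
    (l : ℝ) : ℝ≥0∞ := ⨆ x : X, ∫⁻ ω, eexp (l * ξ x ω) ∂P

theorem naturalFunction_eq_log {X Ω : Type*} [MeasurableSpace Ω] (P : Measure Ω)
    (ξ : X → Ω → ℝ) : naturalFunction P ξ = fun l => ENNReal.log (momentSup P ξ l) := rfl

theorem exp_le_one_add_add_sq_mul_exp (t : ℝ) :
    Real.exp t ≤ 1 + t + t ^ 2 * Real.exp |t| := by
  have h := Complex.norm_exp_sub_sum_le_norm_mul_exp (t : ℂ) 2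
  simp only [Finset.sum_range_succ, Finset.sum_range_zero, pow_zero, Nat.factorial, pow_one,
    Nat.cast_one, div_one, zero_add, Complex.norm_real, Real.norm_eq_abs, sq_abs] at h
  have h2 : Complex.exp t - (1 + t / ((0 + 1) * 1 : ℕ)) = ((Real.exp t - (1 + t) : ℝ) : ℂ) := by
    push_cast; ring
  rw [h2, Complex.norm_real, Real.norm_eq_abs] at h
  linarith [le_abs_self (Real.exp t - (1 + t))]

theorem two_add_sq_le_exp_add_exp_neg (x : ℝ) :
    2 + x ^ 2 / 2 ≤ Real.exp x + Real.exp (-x) := by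
  wlog hx : 0 ≤ x generalizing x
  · have := this (-x) (by linarith)
    rw [neg_neg, neg_sq] at this
    linarith
  · linarith [Real.quadratic_le_exp_of_nonneg hx, Real.add_one_le_exp (-x)]

/-- A quadratic bound of the moment generating function of a centred random variable near `0`. -/
theorem lintegral_eexp_le_quad {Ω : Type*} [MeasurableSpace Ω] {P : Measure Ω}
    [IsProbabilityMeasure P] {η : Ω → ℝ} (hη : Integrable η P) (h0 : ∫ ω, η ω ∂P = 0)
    {L B : ℝ} (hL : 0 < L) (hB0 : 0 ≤ B) (hB : ∫⁻ ω, eexp (L * |η ω|) ∂P ≤ ENNReal.ofReal B)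
    {l : ℝ} (hl : |l| ≤ L / 2) :
    ∫⁻ ω, eexp (l * η ω) ∂P ≤ ENNReal.ofReal (1 + 8 * B / L ^ 2 * l ^ 2) := by
  have hpt : ∀ ω, Real.exp (l * η ω)
      ≤ 1 + l * η ω + 8 / L ^ 2 * l ^ 2 * Real.exp (L * |η ω|) := fun ω => by
    refine (exp_le_one_add_add_sq_mul_exp _).trans (add_le_add_right ?_ _)
    -- The exponent L|η| is split in two halves: one bounds exp|lη|, the other absorbs η² through
    -- (L|η|/2)² ≤ 2 exp(L|η|/2), whence the factor 8/L².
    have h1 : |l * η ω| ≤ L / 2 * |η ω| := by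
      rw [abs_mul]; exact mul_le_mul_of_nonneg_right hl (abs_nonneg _)
    have h2 := Real.quadratic_le_exp_of_nonneg (x := L / 2 * |η ω|) (by positivity)
    have h3 : (L / 2 * |η ω|) ^ 2 ≤ 2 * Real.exp (L / 2 * |η ω|) := by
      nlinarith [mul_nonneg hL.le (abs_nonneg (η ω))]
    have h4 : Real.exp (L * |η ω|) = Real.exp (L / 2 * |η ω|) * Real.exp (L / 2 * |η ω|) := by
      rw [← Real.exp_add]; ring_nf
    have h5 : η ω ^ 2 ≤ 8 / L ^ 2 * Real.exp (L / 2 * |η ω|) := by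
      rw [div_mul_eq_mul_div, le_div_iff₀ (by positivity)]
      rw [mul_pow, sq_abs] at h3
      nlinarith
    calc (l * η ω) ^ 2 * Real.exp |l * η ω|
        = l ^ 2 * (η ω ^ 2 * Real.exp |l * η ω|) := by ring
      _ ≤ l ^ 2 * (8 / L ^ 2 * Real.exp (L / 2 * |η ω|) * Real.exp (L / 2 * |η ω|)) := by
          gcongr
      _ = _ := by rw [h4]; ring
  have hi : Integrable (fun ω => Real.exp (L * |η ω|)) P := by
    refine ⟨(Real.continuous_exp.comp (continuous_const.mul continuous_abs)).comp_aestronglyMeasurable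
      hη.aestronglyMeasurable, ?_⟩
    rw [hasFiniteIntegral_iff_ofReal (Eventually.of_forall fun ω => (Real.exp_pos _).le)]
    exact hB.trans_lt ENNReal.ofReal_lt_top
  have hiB : ∫ ω, Real.exp (L * |η ω|) ∂P ≤ B := by
    rw [← ENNReal.ofReal_le_ofReal_iff hB0, ofReal_integral_eq_lintegral_ofReal hi
      (Eventually.of_forall fun ω => (Real.exp_pos _).le)]
    exact hB
  have h1l : Integrable (fun ω => 1 + l * η ω) P := (integrable_const 1).add (hη.const_mul l)
  calc ∫⁻ ω, eexp (l * η ω) ∂P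
      ≤ ∫⁻ ω, ENNReal.ofReal (1 + l * η ω + 8 / L ^ 2 * l ^ 2 * Real.exp (L * |η ω|)) ∂P :=
        lintegral_mono fun ω => ENNReal.ofReal_le_ofReal (hpt ω)
    _ = ENNReal.ofReal (∫ ω, (1 + l * η ω + 8 / L ^ 2 * l ^ 2 * Real.exp (L * |η ω|)) ∂P) :=
        (ofReal_integral_eq_lintegral_ofReal (h1l.add (hi.const_mul _))
          (Eventually.of_forall fun ω => (Real.exp_pos _).le.trans (hpt ω))).symm
    _ ≤ _ := by
        refine ENNReal.ofReal_le_ofReal ?_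
        rw [integral_add h1l (hi.const_mul _), integral_add (integrable_const 1) (hη.const_mul l),
          integral_const_mul, integral_const_mul, h0]
        simp only [integral_const, probReal_univ, smul_eq_mul, mul_zero, mul_one, add_zero]
        have := mul_le_mul_of_nonneg_left hiB (by positivity : 0 ≤ 8 / L ^ 2 * l ^ 2)
        calc _ ≤ 1 + 8 / L ^ 2 * l ^ 2 * B := by linarith
          _ = _ := by ring

section Moment

variable {X Ω : Type*} [MeasurableSpace Ω] {P : Measure Ω} {ξ : X → Ω → ℝ}

theorem lintegral_eexp_le_momentSup (x : X) (l : ℝ) :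
    ∫⁻ ω, eexp (l * ξ x ω) ∂P ≤ momentSup P ξ l :=
  le_iSup (fun x => ∫⁻ ω, eexp (l * ξ x ω) ∂P) x

theorem eexp_mul_abs_le (l x : ℝ) : eexp (l * |x|) ≤ eexp (l * x) + eexp (-l * x) := by
  rcases abs_choice x with h | h <;> rw [h]
  · exact le_self_add
  · rw [mul_neg, neg_mul]; exact le_add_self

theorem momentSup_even
    (heven : ∀ l, naturalFunction P ξ (-l) = naturalFunction P ξ l) (l : ℝ) :
    momentSup P ξ (-l) = momentSup P ξ l := ENNReal.log_injective (heven l)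

theorem lintegral_eexp_abs_le (hξ : ∀ x, Measurable (ξ x))
    (heven : ∀ l, naturalFunction P ξ (-l) = naturalFunction P ξ l) (x : X) (l : ℝ) :
    ∫⁻ ω, eexp (l * |ξ x ω|) ∂P ≤ 2 * momentSup P ξ l :=
  calc ∫⁻ ω, eexp (l * |ξ x ω|) ∂P ≤ ∫⁻ ω, (eexp (l * ξ x ω) + eexp (-l * ξ x ω)) ∂P :=
        lintegral_mono fun ω => eexp_mul_abs_le _ _
    _ = ∫⁻ ω, eexp (l * ξ x ω) ∂P + ∫⁻ ω, eexp (-l * ξ x ω) ∂P :=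
        lintegral_add_left (measurable_eexp.comp ((hξ x).const_mul l)) _
    _ ≤ momentSup P ξ l + momentSup P ξ l := by
        refine add_le_add (lintegral_eexp_le_momentSup x l) ?_
        rw [← momentSup_even heven l]
        exact lintegral_eexp_le_momentSup x (-l)
    _ = _ := (two_mul _).symm

variable [IsProbabilityMeasure P]

/-- Evenness of φ allows averaging over l and -l, which cancels the linear term of the exponential.
-/
theorem one_add_sq_le_momentSup (hξ : ∀ x, Measurable (ξ x))
    (heven : ∀ l, naturalFunction P ξ (-l) = naturalFunction P ξ l) (x : X) (l : ℝ) :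
    1 + ENNReal.ofReal (l ^ 2 / 4) * ∫⁻ ω, ENNReal.ofReal (ξ x ω ^ 2) ∂P ≤ momentSup P ξ l := by
  have h : 2 * (1 + ENNReal.ofReal (l ^ 2 / 4) * ∫⁻ ω, ENNReal.ofReal (ξ x ω ^ 2) ∂P)
      ≤ 2 * momentSup P ξ l := by
    calc 2 * (1 + ENNReal.ofReal (l ^ 2 / 4) * ∫⁻ ω, ENNReal.ofReal (ξ x ω ^ 2) ∂P)
        = ∫⁻ ω, (2 + 2 * (ENNReal.ofReal (l ^ 2 / 4) * ENNReal.ofReal (ξ x ω ^ 2))) ∂P := by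
          rw [lintegral_add_left measurable_const, lintegral_const_mul _
            (((hξ x).pow_const 2).ennreal_ofReal.const_mul _), lintegral_const_mul _
            ((hξ x).pow_const 2).ennreal_ofReal]
          simp [mul_add]
      _ ≤ ∫⁻ ω, (eexp (l * ξ x ω) + eexp (-l * ξ x ω)) ∂P := by
          refine lintegral_mono fun ω => ?_
          rw [← ENNReal.ofReal_mul (by positivity), ← ENNReal.ofReal_ofNat 2,
            ← ENNReal.ofReal_mul (by positivity), ← ENNReal.ofReal_add (by positivity)
            (by positivity), ← ENNReal.ofReal_add (Real.exp_pos _).le (Real.exp_pos _).le]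
          refine ENNReal.ofReal_le_ofReal ?_
          have := two_add_sq_le_exp_add_exp_neg (l * ξ x ω)
          rw [neg_mul]
          refine le_trans (le_of_eq ?_) this
          ring
      _ = ∫⁻ ω, eexp (l * ξ x ω) ∂P + ∫⁻ ω, eexp (-l * ξ x ω) ∂P :=
          lintegral_add_left (measurable_eexp.comp ((hξ x).const_mul l)) _
      _ ≤ momentSup P ξ l + momentSup P ξ l := by
          refine add_le_add (lintegral_eexp_le_momentSup x l) ?_
          rw [← momentSup_even heven l]
          exact lintegral_eexp_le_momentSup x (-l)
      _ = _ := (two_mul _).symm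
  exact (ENNReal.mul_le_mul_iff_right two_ne_zero ENNReal.ofNat_ne_top).1 h

theorem isMoment_momentSup [Nonempty X] (hξ : ∀ x, Measurable (ξ x))
    (hcentred : ∀ x : X, Integrable (ξ x) P ∧ ∫ ω, ξ x ω ∂P = 0) (hcramer : UniformCramer P ξ)
    (heven : ∀ l, naturalFunction P ξ (-l) = naturalFunction P ξ l) :
    IsMoment (momentSup P ξ) where
  one_le l := le_trans le_self_add (one_add_sq_le_momentSup hξ heven (Classical.arbitrary X) l)
  map_zero := by simp [momentSup, eexp]
  even := momentSup_even heven
  map_mul_le t l ht ht1 := by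
    refine iSup_le fun x => ?_
    -- Lyapunov's inequality: Hölder with weights t and 1 - t against the constant 1.
    have h := ENNReal.lintegral_mul_norm_pow_le (μ := P) (f := fun ω => eexp (l * ξ x ω))
      (g := fun _ => 1) (measurable_eexp.comp ((hξ x).const_mul l)).aemeasurable
      aemeasurable_const ht (sub_nonneg.2 ht1) (by ring)
    simp only [ENNReal.one_rpow, mul_one, lintegral_const, measure_univ, eexp_rpow,
      ← mul_assoc] at h
    exact h.trans (ENNReal.rpow_le_rpow (lintegral_eexp_le_momentSup x l) ht)
  quad := by
    obtain ⟨l₀, hl₀, h⟩ := hcramer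
    have hlt : momentSup P ξ (l₀ / 2) < ⊤ := by
      have := h (l₀ / 2) (by rw [abs_of_pos (by positivity)]; linarith)
      rw [naturalFunction_eq_log, ENNReal.log_lt_top_iff] at this
      exact this
    refine ⟨l₀ / 2 / 2, _, by positivity, ?_, fun l hl => iSup_le fun x =>
      lintegral_eexp_le_quad (hcentred x).1 (hcentred x).2 (L := l₀ / 2)
      (B := (2 * momentSup P ξ (l₀ / 2)).toReal) (by positivity) ENNReal.toReal_nonneg ?_ hl⟩
    · positivity
    · rw [ENNReal.ofReal_toReal (ENNReal.mul_ne_top ENNReal.ofNat_ne_top hlt.ne)]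
      exact lintegral_eexp_abs_le hξ heven x _

end Moment

/-! ### The Luxemburg norm. -/

section Orlicz

variable {Ω : Type*} [MeasurableSpace Ω] {P : Measure Ω} {M : ℝ → ℝ≥0∞} {η : Ω → ℝ}

theorem orliczNorm_le {Φ : ℝ → ℝ≥0∞} {k : ℝ} (hk : 0 < k) (h : ∫⁻ ω, Φ (|η ω| / k) ∂P ≤ 1) :
    orliczNorm P Φ η ≤ ENNReal.ofReal k :=
  iInf_le_of_le k (iInf_le_of_le hk (iInf_le_of_le h le_rfl))

namespace IsMoment

variable (hM : IsMoment M)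
include hM

theorem lintegral_le_of_orliczNorm_lt {k : ℝ}
    (h : orliczNorm P (dualOrlicz M) η < ENNReal.ofReal k) :
    ∫⁻ ω, dualOrlicz M (|η ω| / k) ∂P ≤ 1 := by
  simp only [orliczNorm, iInf_lt_iff] at h
  obtain ⟨k', hk', h1, hlt⟩ := h
  have hkk : k' < k := (ENNReal.ofReal_lt_ofReal_iff_of_nonneg hk'.le).1 hlt
  refine (lintegral_mono fun ω => ?_).trans h1
  exact hM.dualOrlicz_mono (div_nonneg (abs_nonneg _) (hk'.trans hkk).le)
    (div_le_div_of_nonneg_left (abs_nonneg _) hk' hkk.le)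

variable [IsProbabilityMeasure P]

theorem lintegral_expDual_le_two {s : Ω → ℝ} (h : ∫⁻ ω, dualOrlicz M (s ω) ∂P ≤ 1) :
    ∫⁻ ω, expDual M (s ω) ∂P ≤ 2 := by
  simp only [← hM.dualOrlicz_add_one]
  rw [lintegral_add_right _ measurable_const, ← one_add_one_eq_two]
  gcongr
  simp

theorem lintegral_dualOrlicz_le_one (s : Ω → ℝ) (h : ∫⁻ ω, expDual M (s ω) ∂P ≤ 2) :
    ∫⁻ ω, dualOrlicz M (s ω) ∂P ≤ 1 := by
  simp only [← hM.dualOrlicz_add_one] at h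
  rw [lintegral_add_right _ measurable_const, ← one_add_one_eq_two] at h
  simp only [lintegral_const, measure_univ, mul_one] at h
  exact (ENNReal.add_le_add_iff_right ENNReal.one_ne_top).1 h

theorem orliczNorm_add_le {η₁ η₂ : Ω → ℝ} (h₁ : Measurable η₁) (h₂ : Measurable η₂) :
    orliczNorm P (dualOrlicz M) (fun ω => η₁ ω + η₂ ω)
      ≤ orliczNorm P (dualOrlicz M) η₁ + orliczNorm P (dualOrlicz M) η₂ := by
  set a := orliczNorm P (dualOrlicz M) η₁ with ha
  set b := orliczNorm P (dualOrlicz M) η₂ with hb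
  by_cases hat : a = ⊤
  · simp [hat]
  by_cases hbt : b = ⊤
  · simp [hbt]
  refine ENNReal.le_of_forall_pos_le_add fun ε hε _ => ?_
  have hε' : (0 : ℝ) < ε := hε
  have hlt : ∀ c : ℝ≥0∞, c ≠ ⊤ → c < ENNReal.ofReal (c.toReal + ε / 2) := fun c hc => by
    conv_lhs => rw [← ENNReal.ofReal_toReal hc]
    exact (ENNReal.ofReal_lt_ofReal_iff_of_nonneg ENNReal.toReal_nonneg).2 (by linarith)
  have h1 := hM.lintegral_le_of_orliczNorm_lt (hlt a hat)
  have h2 := hM.lintegral_le_of_orliczNorm_lt (hlt b hbt)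
  set k₁ := a.toReal + ε / 2
  set k₂ := b.toReal + ε / 2
  have hk₁ : 0 < k₁ := add_pos_of_nonneg_of_pos ENNReal.toReal_nonneg (by positivity)
  have hk₂ : 0 < k₂ := add_pos_of_nonneg_of_pos ENNReal.toReal_nonneg (by positivity)
  have hk : orliczNorm P (dualOrlicz M) (fun ω => η₁ ω + η₂ ω) ≤ ENNReal.ofReal (k₁ + k₂) := by
    refine orliczNorm_le (by positivity) (hM.lintegral_dualOrlicz_le_one _ ?_)
    -- The sum over k₁ + k₂ is dominated by a convex combination of the normalised terms with
    -- weights kᵢ/(k₁ + k₂).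
    have hpt : ∀ ω, expDual M (|η₁ ω + η₂ ω| / (k₁ + k₂))
        ≤ ENNReal.ofReal (k₁ / (k₁ + k₂)) * expDual M (|η₁ ω| / k₁)
          + ENNReal.ofReal (k₂ / (k₁ + k₂)) * expDual M (|η₂ ω| / k₂) := fun ω => by
      refine le_trans (hM.expDual_mono (by positivity)
        (?_ : _ ≤ k₁ / (k₁ + k₂) * (|η₁ ω| / k₁) + k₂ / (k₁ + k₂) * (|η₂ ω| / k₂)))
        (hM.expDual_convex (by positivity) (by positivity) (by field_simp))
      have : k₁ / (k₁ + k₂) * (|η₁ ω| / k₁) + k₂ / (k₁ + k₂) * (|η₂ ω| / k₂)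
          = (|η₁ ω| + |η₂ ω|) / (k₁ + k₂) := by field_simp
      rw [this]
      gcongr
      exact abs_add_le _ _
    calc _ ≤ _ := lintegral_mono hpt
      _ = ENNReal.ofReal (k₁ / (k₁ + k₂)) * ∫⁻ ω, expDual M (|η₁ ω| / k₁) ∂P
          + ENNReal.ofReal (k₂ / (k₁ + k₂)) * ∫⁻ ω, expDual M (|η₂ ω| / k₂) ∂P := by
          have hm : ∀ (η : Ω → ℝ) (k : ℝ), Measurable η →
              Measurable fun ω => expDual M (|η ω| / k) := fun η k h =>
            hM.measurable_expDual.comp ((measurable_abs.comp h).div_const k)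
          rw [lintegral_add_left ((hm _ _ h₁).const_mul _), lintegral_const_mul _ (hm _ _ h₁),
            lintegral_const_mul _ (hm _ _ h₂)]
      _ ≤ ENNReal.ofReal (k₁ / (k₁ + k₂)) * 2 + ENNReal.ofReal (k₂ / (k₁ + k₂)) * 2 := by
          gcongr
          · exact hM.lintegral_expDual_le_two h1
          · exact hM.lintegral_expDual_le_two h2
      _ = 2 := by
          rw [← add_mul, ← ENNReal.ofReal_add (by positivity) (by positivity), ← add_div,
            div_self (by positivity), ENNReal.ofReal_one, one_mul]
  refine hk.trans (le_of_eq ?_)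
  rw [← ENNReal.ofReal_toReal hat, ← ENNReal.ofReal_toReal hbt, ← ENNReal.ofReal_coe_nnreal (p := ε),
    ← ENNReal.ofReal_add ENNReal.toReal_nonneg ENNReal.toReal_nonneg,
    ← ENNReal.ofReal_add (add_nonneg ENNReal.toReal_nonneg ENNReal.toReal_nonneg) hε'.le]
  congr 1
  simp only [k₁, k₂]
  ring

omit [IsProbabilityMeasure P] in
/-- The infimum in the Luxemburg norm is attained. -/
theorem lintegral_div_orliczNorm_le (hη : Measurable η) {k : ℝ} (hk : 0 < k)
    (h : orliczNorm P (dualOrlicz M) η ≤ ENNReal.ofReal k) :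
    ∫⁻ ω, dualOrlicz M (|η ω| / k) ∂P ≤ 1 := by
  -- Every denominator k + 1/(n + 1) is admissible. Left continuity along rays lets them exhaust the
  -- value at k, and monotone convergence does the rest.
  have hpt : ∀ ω, dualOrlicz M (|η ω| / k)
      ≤ ⨆ n : ℕ, dualOrlicz M (|η ω| / (k + 1 / ((n : ℝ) + 1))) := fun ω => by
    refine dualOrlicz_le_iff.2 (hM.expDual_le_of_forall_lt fun t ht0 ht1 => ?_)
    have hpos : 0 < k / t - k := sub_pos.2 (by rw [lt_div_iff₀ ht0]; nlinarith)
    obtain ⟨n, hn⟩ := exists_nat_one_div_lt hpos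
    refine le_trans ?_ (dualOrlicz_le_iff.1
      (le_iSup (fun n : ℕ => dualOrlicz M (|η ω| / (k + 1 / ((n : ℝ) + 1)))) n))
    refine hM.expDual_mono (by positivity) ?_
    have h1 : t * (|η ω| / k) = |η ω| / (k / t) := by field_simp
    rw [h1]
    exact div_le_div_of_nonneg_left (abs_nonneg _) (by positivity) (by linarith)
  refine (lintegral_mono hpt).trans ?_
  rw [lintegral_iSup]
  · refine iSup_le fun n => hM.lintegral_le_of_orliczNorm_lt (h.trans_lt ?_)
    exact (ENNReal.ofReal_lt_ofReal_iff_of_nonneg hk.le).2 (by simp; positivity)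
  · exact fun n => hM.measurable_dualOrlicz.comp ((measurable_abs.comp hη).div_const _)
  · intro i j hij ω
    refine hM.dualOrlicz_mono (by positivity) ?_
    have : (1 : ℝ) / ((j : ℝ) + 1) ≤ 1 / ((i : ℝ) + 1) := Nat.one_div_le_one_div hij
    exact div_le_div_of_nonneg_left (abs_nonneg _) (by positivity) (by linarith)

/-- The Luxemburg norm dominates the `L¹` norm. -/
theorem exists_lintegral_abs_le : ∃ C : ℝ≥0∞, C ≠ ⊤ ∧ ∀ η : Ω → ℝ, Measurable η →
    ∫⁻ ω, ENNReal.ofReal |η ω| ∂P ≤ C * orliczNorm P (dualOrlicz M) η := by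
  obtain ⟨L, hL, hML⟩ := hM.exists_lt_top
  have h0 : M L * 2 / ENNReal.ofReal L ≠ 0 :=
    ENNReal.div_ne_zero.2 ⟨mul_ne_zero (hM.ne_zero L) two_ne_zero, ENNReal.ofReal_ne_top⟩
  have ht : M L * 2 / ENNReal.ofReal L ≠ ⊤ :=
    ENNReal.div_ne_top (ENNReal.mul_ne_top hML.ne ENNReal.ofNat_ne_top) (by simpa using hL)
  refine ⟨M L * 2 / ENNReal.ofReal L, ht, fun η hη => ?_⟩
  simp only [orliczNorm, ENNReal.mul_iInf_of_ne h0 ht]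
  refine le_iInf fun k => le_iInf fun hk => le_iInf fun h => ?_
  have h1 : ENNReal.ofReal (L / k) * ∫⁻ ω, ENNReal.ofReal |η ω| ∂P ≤ M L * 2 := by
    rw [← lintegral_const_mul _ hη.abs.ennreal_ofReal]
    calc ∫⁻ ω, ENNReal.ofReal (L / k) * ENNReal.ofReal |η ω| ∂P
        ≤ ∫⁻ ω, M L * expDual M (|η ω| / k) ∂P := by
          refine lintegral_mono fun ω => le_trans ?_ (hM.eexp_le L _)
          rw [← ENNReal.ofReal_mul (by positivity)]
          refine ENNReal.ofReal_le_ofReal ?_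
          have := Real.add_one_le_exp (L * (|η ω| / k))
          rw [div_mul_eq_mul_div, mul_div_assoc]
          linarith
      _ = M L * ∫⁻ ω, expDual M (|η ω| / k) ∂P := lintegral_const_mul _
          (hM.measurable_expDual.comp ((measurable_abs.comp hη).div_const k))
      _ ≤ _ := by gcongr; exact hM.lintegral_expDual_le_two h
  rw [ENNReal.ofReal_div_of_pos hk] at h1
  rw [← ENNReal.mul_div_right_comm, ENNReal.le_div_iff_mul_le (Or.inl (by simpa using hL))
    (Or.inl ENNReal.ofReal_ne_top)]
  have hk0 : ENNReal.ofReal k ≠ 0 := by simpa using hk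
  calc (∫⁻ ω, ENNReal.ofReal |η ω| ∂P) * ENNReal.ofReal L
      = ENNReal.ofReal L / ENNReal.ofReal k * (∫⁻ ω, ENNReal.ofReal |η ω| ∂P)
          * ENNReal.ofReal k := by
        rw [mul_right_comm, ENNReal.div_mul_cancel hk0 ENNReal.ofReal_ne_top, mul_comm]
    _ ≤ _ := by gcongr

end IsMoment

end Orlicz

/-! ### The natural distance as a measurable pseudometric. -/

section NatDist

variable {X Ω : Type*} [MeasurableSpace Ω] {P : Measure Ω} {M : ℝ → ℝ≥0∞} {ξ : X → Ω → ℝ}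

theorem natDist_comm (Φ : ℝ → ℝ≥0∞) (x y : X) : natDist P Φ ξ x y = natDist P Φ ξ y x := by
  simp only [natDist, orliczNorm, abs_sub_comm]

variable [IsProbabilityMeasure P] (hM : IsMoment M)
include hM

theorem natDist_triangle (hξ : ∀ x, Measurable (ξ x)) (x y z : X) :
    natDist P (dualOrlicz M) ξ x z
      ≤ natDist P (dualOrlicz M) ξ x y + natDist P (dualOrlicz M) ξ y z := by
  refine le_trans (le_of_eq ?_)
    (hM.orliczNorm_add_le ((hξ x).sub (hξ y)) ((hξ y).sub (hξ z)))
  simp [natDist]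

omit [IsProbabilityMeasure P] in
theorem natDist_eq_zero_of_ae_eq {x y : X} (h : ξ x =ᵐ[P] ξ y) :
    natDist P (dualOrlicz M) ξ x y = 0 := by
  refine le_antisymm (ENNReal.le_of_forall_pos_le_add fun ε hε _ => ?_) zero_le
  rw [zero_add, ← ENNReal.ofReal_coe_nnreal]
  refine orliczNorm_le hε ?_
  rw [lintegral_eq_zero_of_ae_eq_zero]
  · exact zero_le
  · filter_upwards [h] with ω hω
    simp [hω, hM.dualOrlicz_zero]

theorem ae_eq_of_natDist_eq_zero (hξ : ∀ x, Measurable (ξ x)) {x y : X}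
    (h : natDist P (dualOrlicz M) ξ x y = 0) : ξ x =ᵐ[P] ξ y := by
  obtain ⟨C, hC, hle⟩ := hM.exists_lintegral_abs_le (P := P)
  have h1 := hle _ ((hξ x).sub (hξ y))
  have h2 : orliczNorm P (dualOrlicz M) (ξ x - ξ y) = 0 := h
  rw [h2, mul_zero, nonpos_iff_eq_zero, lintegral_eq_zero_iff
    ((hξ x).sub (hξ y)).abs.ennreal_ofReal] at h1
  filter_upwards [h1] with ω hω
  simp only [Pi.sub_apply, Pi.zero_apply, ENNReal.ofReal_eq_zero, abs_nonpos_iff] at hω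
  linarith

theorem measurable_natDist [MeasurableSpace X] (hmeas : Measurable (Function.uncurry ξ)) :
    Measurable fun p : X × X => natDist P (dualOrlicz M) ξ p.1 p.2 := by
  refine measurable_of_Iio fun t => ?_
  -- Rational values of k suffice in the infimum, so a strict sublevel set is a countable union of
  -- sets that Tonelli shows to be measurable.
  have hset : (fun p : X × X => natDist P (dualOrlicz M) ξ p.1 p.2) ⁻¹' Set.Iio t
      = ⋃ q : ℚ, {p : X × X | 0 < (q : ℝ) ∧ ENNReal.ofReal q < t ∧
          ∫⁻ ω, dualOrlicz M (|ξ p.1 ω - ξ p.2 ω| / q) ∂P ≤ 1} := by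
    ext ⟨x, y⟩
    simp only [Set.mem_preimage, Set.mem_Iio, Set.mem_iUnion, Set.mem_ofPred_eq]
    constructor
    · intro h
      obtain ⟨q, hq, h1, h2⟩ := ENNReal.lt_iff_exists_rat_btwn.1 h
      have h1' : natDist P (dualOrlicz M) ξ x y < ENNReal.ofReal q := h1
      have hq0 : (0 : ℝ) < q := by
        by_contra! hneg
        rw [ENNReal.ofReal_of_nonpos hneg] at h1'
        exact not_lt_zero h1'
      exact ⟨q, hq0, h2, hM.lintegral_le_of_orliczNorm_lt h1'⟩
    · rintro ⟨q, hq, hqt, h⟩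
      exact (orliczNorm_le hq h).trans_lt hqt
  rw [hset]
  refine MeasurableSet.iUnion fun q => ?_
  refine MeasurableSet.inter (MeasurableSet.const _) (MeasurableSet.inter (MeasurableSet.const _) ?_)
  refine measurableSet_le (Measurable.lintegral_prod_right' (f := fun p : (X × X) × Ω =>
    dualOrlicz M (|ξ p.1.1 p.2 - ξ p.1.2 p.2| / q)) ?_) measurable_const
  refine hM.measurable_dualOrlicz.comp (Measurable.div_const (measurable_abs.comp ?_) _)
  exact (hmeas.comp (measurable_fst.fst.prodMk measurable_snd)).sub
    (hmeas.comp (measurable_fst.snd.prodMk measurable_snd))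

end NatDist

/-! ### Deterministic chaining through averages over balls. -/

section Chaining

variable {X : Type*} [MeasurableSpace X]

/-- The mean of `|f(y) - f(z)|` for independent `y`, `z` with distributions `μ`, `ν`. -/
noncomputable def meanDist (f : X → ℝ) (μ ν : Measure X) : ℝ≥0∞ :=
  ∫⁻ y, ∫⁻ z, ENNReal.ofReal |f y - f z| ∂ν ∂μ

theorem measurable_ofReal_abs_sub {f : X → ℝ} (hf : Measurable f) :
    Measurable fun p : X × X => ENNReal.ofReal |f p.1 - f p.2| :=
  ((hf.comp measurable_fst).sub (hf.comp measurable_snd)).abs.ennreal_ofReal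

theorem meanDist_comm {f : X → ℝ} (hf : Measurable f) (μ ν : Measure X) [SFinite μ] [SFinite ν] :
    meanDist f μ ν = meanDist f ν μ := by
  rw [meanDist, lintegral_lintegral_swap (measurable_ofReal_abs_sub hf).aemeasurable]
  simp only [meanDist, abs_sub_comm]

/-- Insert a third independent point with distribution κ and integrate the triangle inequality for
|·|. -/
theorem meanDist_triangle {f : X → ℝ} (hf : Measurable f) (μ κ ν : Measure X)
    [IsProbabilityMeasure μ] [IsProbabilityMeasure κ] [IsProbabilityMeasure ν] :
    meanDist f μ ν ≤ meanDist f μ κ + meanDist f κ ν := by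
  have hm := measurable_ofReal_abs_sub hf
  have h1 : ∀ y, ∫⁻ z, ENNReal.ofReal |f y - f z| ∂ν
      ≤ ∫⁻ w, ENNReal.ofReal |f y - f w| ∂κ + meanDist f κ ν := fun y => by
    rw [meanDist_comm hf κ ν]
    have h2 : ∀ z, ENNReal.ofReal |f y - f z| ≤ ∫⁻ w, ENNReal.ofReal |f y - f w| ∂κ
        + ∫⁻ w, ENNReal.ofReal |f z - f w| ∂κ := fun z => by
      have h3 : Measurable fun w => ENNReal.ofReal |f y - f w| :=
        hm.comp (measurable_const.prodMk measurable_id)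
      rw [← lintegral_add_left h3]
      calc ENNReal.ofReal |f y - f z| = ∫⁻ _, ENNReal.ofReal |f y - f z| ∂κ := by simp
        _ ≤ _ := lintegral_mono fun w => by
          rw [← ENNReal.ofReal_add (abs_nonneg _) (abs_nonneg _), abs_sub_comm (f z)]
          exact ENNReal.ofReal_le_ofReal (abs_sub_le _ _ _)
    refine (lintegral_mono h2).trans (le_of_eq ?_)
    rw [lintegral_add_left measurable_const, meanDist]
    simp
  refine (lintegral_mono h1).trans (le_of_eq ?_)
  rw [lintegral_add_right _ measurable_const, meanDist]
  simp [meanDist]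

theorem meanDist_dirac_dirac {f : X → ℝ} (hf : Measurable f) (x y : X) :
    meanDist f (Measure.dirac x) (Measure.dirac y) = ENNReal.ofReal |f x - f y| := by
  have hm := measurable_ofReal_abs_sub hf
  have h : Measurable fun z => ENNReal.ofReal |f x - f z| :=
    hm.comp (measurable_const.prodMk measurable_id)
  rw [meanDist, lintegral_dirac' _ hm.lintegral_prod_right', lintegral_dirac' _ h]

theorem meanDist_dirac {f : X → ℝ} (hf : Measurable f) (x : X) (ν : Measure X) [SFinite ν] :
    meanDist f (Measure.dirac x) ν = ∫⁻ z, ENNReal.ofReal |f x - f z| ∂ν := by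
  rw [meanDist, lintegral_dirac' _ (measurable_ofReal_abs_sub hf).lintegral_prod_right']

variable {m : Measure X} {d : X → X → ℝ≥0∞}

/-- The normalised restriction of `m` to the closed `d`-ball of radius `r` around `x`. -/
noncomputable def ballMean (m : Measure X) (d : X → X → ℝ≥0∞) (x : X) (r : ℝ) : Measure X :=
  ProbabilityTheory.cond m {y | d x y ≤ ENNReal.ofReal r}

theorem minBall_le (x : X) (r : ℝ) : minBall m d r ≤ m {y | d x y ≤ ENNReal.ofReal r} :=
  iInf_le _ x

theorem minBall_mono : Monotone (minBall m d) := fun _ _ h =>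
  iInf_mono fun _ => measure_mono fun _ hy => le_trans hy (ENNReal.ofReal_le_ofReal h)

theorem antitone_orliczInv_div_minBall (Φ : ℝ → ℝ≥0∞) (V : ℝ≥0∞) :
    Antitone fun r => orliczInv Φ (V / minBall m d r ^ 2) := fun _ _ h =>
  orliczInv_mono Φ (ENNReal.div_le_div_left (pow_le_pow_left₀ zero_le (minBall_mono h) 2) _)

theorem isProbabilityMeasure_ballMean [IsFiniteMeasure m] {r : ℝ} (hr : minBall m d r ≠ 0) (x : X) :
    IsProbabilityMeasure (ballMean m d x r) :=
  ProbabilityTheory.cond_isProbabilityMeasure fun h => hr (le_antisymm (h ▸ minBall_le x r) zero_le)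

theorem lintegral_ballMean_le {r : ℝ} (x : X) (g : X → ℝ≥0∞) :
    ∫⁻ y, g y ∂(ballMean m d x r)
      ≤ (minBall m d r)⁻¹ * ∫⁻ y in {y | d x y ≤ ENNReal.ofReal r}, g y ∂m := by
  rw [ballMean, ProbabilityTheory.cond, lintegral_smul_measure, smul_eq_mul]
  gcongr
  exact minBall_le x r

/-- One link of the chain. -/
theorem meanDist_ballMean_le [IsProbabilityMeasure m] {M : ℝ → ℝ≥0∞} (hM : IsMoment M)
    (hball : ∀ x r, MeasurableSet {y | d x y ≤ ENNReal.ofReal r}) (hfin : ∀ x y, d x y ≠ ⊤)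
    {f : X → ℝ} (hf : Measurable f) (hzero : ∀ᵐ y ∂m, ∀ᵐ z ∂m, d y z = 0 → f y = f z)
    {Z : ℝ≥0∞} (hZ : ∫⁻ y, ∫⁻ z, dualOrlicz M (|f y - f z| / (d y z).toReal) ∂m ∂m ≤ Z)
    {x₁ x₂ : X} {r₁ r₂ R : ℝ} (hr : minBall m d r₁ ≠ 0) (hr₁₂ : r₁ ≤ r₂) (hR : 0 < R)
    (hdR : ∀ y z, d x₁ y ≤ ENNReal.ofReal r₁ → d x₂ z ≤ ENNReal.ofReal r₂ →
      d y z ≤ ENNReal.ofReal R) :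
    meanDist f (ballMean m d x₁ r₁) (ballMean m d x₂ r₂)
      ≤ ENNReal.ofReal R * orliczInv (dualOrlicz M) (Z / minBall m d r₁ ^ 2) := by
  have hr2 : minBall m d r₂ ≠ 0 := fun h => hr (le_antisymm (h ▸ minBall_mono hr₁₂) zero_le)
  have := isProbabilityMeasure_ballMean hr x₁
  have := isProbabilityMeasure_ballMean hr2 x₂
  set μ := (ballMean m d x₁ r₁).prod (ballMean m d x₂ r₂)
  have hms : Measurable fun p : X × X => |f p.1 - f p.2| / R :=
    ((hf.comp measurable_fst).sub (hf.comp measurable_snd)).abs.div_const R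
  have hint : ∫⁻ p, dualOrlicz M (|f p.1 - f p.2| / R) ∂μ ≤ Z / minBall m d r₁ ^ 2 := by
    have hmΦ : Measurable fun p : X × X => dualOrlicz M (|f p.1 - f p.2| / R) :=
      hM.measurable_dualOrlicz.comp hms
    rw [lintegral_prod _ hmΦ.aemeasurable]
    have hc : (minBall m d r₂)⁻¹ ≤ (minBall m d r₁)⁻¹ := ENNReal.inv_le_inv.2 (minBall_mono hr₁₂)
    -- Each normalised ball costs a factor at most 1/h_-(r₁), and on the product of the balls R may
    -- be lowered to d(y,z).
    calc ∫⁻ y, ∫⁻ z, dualOrlicz M (|f y - f z| / R) ∂(ballMean m d x₂ r₂) ∂(ballMean m d x₁ r₁)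
        ≤ (minBall m d r₁)⁻¹ * ∫⁻ y in {y | d x₁ y ≤ ENNReal.ofReal r₁},
            (minBall m d r₁)⁻¹ * ∫⁻ z, dualOrlicz M (|f y - f z| / (d y z).toReal) ∂m ∂m := by
          refine (lintegral_ballMean_le _ _).trans (mul_le_mul' le_rfl ?_)
          refine setLIntegral_mono_ae' (hball _ _) ?_
          filter_upwards [hzero] with y hy hyB
          refine (lintegral_ballMean_le _ _).trans (mul_le_mul' hc ?_)
          refine (setLIntegral_mono_ae' (hball _ _) ?_).trans (setLIntegral_le_lintegral _ _)
          filter_upwards [hy] with z hz hzB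
          -- Where d(y,z) = 0 the integrand of Z vanishes by division by zero, so f y = f z is
          -- needed on the left.
          by_cases hd : d y z = 0
          · rw [hz hd]; simp
          · refine hM.dualOrlicz_mono (by positivity) ?_
            exact div_le_div_of_nonneg_left (abs_nonneg _) (ENNReal.toReal_pos hd (hfin y z))
              (ENNReal.toReal_le_of_le_ofReal hR.le (hdR y z hyB hzB))
      _ ≤ (minBall m d r₁)⁻¹ * ((minBall m d r₁)⁻¹ *
            ∫⁻ y, ∫⁻ z, dualOrlicz M (|f y - f z| / (d y z).toReal) ∂m ∂m) := by
          gcongr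
          rw [lintegral_const_mul' _ _ (ENNReal.inv_ne_top.2 hr)]
          gcongr
          exact Measure.restrict_le_self
      _ ≤ (minBall m d r₁)⁻¹ * ((minBall m d r₁)⁻¹ * Z) := by gcongr
      _ = Z / minBall m d r₁ ^ 2 := by
          rw [← mul_assoc, div_eq_mul_inv, mul_comm Z, pow_two, ENNReal.mul_inv (Or.inl hr)
            (Or.inr hr)]
  have hJ := hM.lintegral_le_orliczInv hms.aemeasurable (fun _ => by positivity) hint
  calc meanDist f (ballMean m d x₁ r₁) (ballMean m d x₂ r₂)
      = ∫⁻ p, ENNReal.ofReal |f p.1 - f p.2| ∂μ :=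
        (lintegral_prod _ (measurable_ofReal_abs_sub hf).aemeasurable).symm
    _ = ENNReal.ofReal R * ∫⁻ p, ENNReal.ofReal (|f p.1 - f p.2| / R) ∂μ := by
        rw [← lintegral_const_mul _ hms.ennreal_ofReal]
        refine lintegral_congr fun p => ?_
        rw [← ENNReal.ofReal_mul hR.le, mul_div_cancel₀ _ hR.ne']
    _ ≤ _ := by gcongr

theorem ofReal_mul_le_setLIntegral {F : ℝ → ℝ≥0∞} (hF : Antitone F) {a b c : ℝ}
    (hbc : b ≤ c) : ENNReal.ofReal (b - a) * F c ≤ ∫⁻ r in Set.Ioo a b, F r := by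
  calc ENNReal.ofReal (b - a) * F c = ∫⁻ _ in Set.Ioo a b, F c := by
        rw [setLIntegral_const, Real.volume_Ioo, mul_comm]
    _ ≤ _ := setLIntegral_mono' measurableSet_Ioo fun r hr => hF (hr.2.le.trans hbc)

theorem setLIntegral_Ioo_add_le (F : ℝ → ℝ≥0∞) {a b c : ℝ} (hab : a ≤ b) (hbc : b ≤ c) :
    (∫⁻ r in Set.Ioo a b, F r) + (∫⁻ r in Set.Ioo b c, F r) ≤ ∫⁻ r in Set.Ioo a c, F r := by
  rw [← lintegral_union measurableSet_Ioo
    (Set.disjoint_left.2 fun s hs hs' => lt_asymm hs.2 hs'.1)]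
  exact lintegral_mono_set (Set.union_subset (Set.Ioo_subset_Ioo_right hbc)
    (Set.Ioo_subset_Ioo_left hab))

theorem wBar_eq (Φ : ℝ → ℝ≥0∞) {x₁ x₂ : X} (h : d x₁ x₂ ≠ ⊤) (V : ℝ≥0∞) :
    wBar m d Φ x₁ x₂ V = 12 * ∫⁻ r in Set.Ioo 0 (d x₁ x₂).toReal,
      orliczInv Φ (4 * V / minBall m d r ^ 2) := by
  have : {r : ℝ | 0 < r ∧ ENNReal.ofReal r < d x₁ x₂} = Set.Ioo 0 (d x₁ x₂).toReal := by
    ext r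
    exact and_congr_right fun hr => ENNReal.ofReal_lt_iff_lt_toReal hr.le h
  rw [wBar, this]

section Chain

variable [IsProbabilityMeasure m] {M : ℝ → ℝ≥0∞} (hM : IsMoment M)
    (hball : ∀ x r, MeasurableSet {y | d x y ≤ ENNReal.ofReal r}) (hfin : ∀ x y, d x y ≠ ⊤)
    (hsymm : ∀ x y, d x y = d y x) (htri : ∀ x y z, d x z ≤ d x y + d y z)
    (hmin : ∀ r, 0 < r → minBall m d r ≠ 0)
    {f : X → ℝ} (hf : Measurable f) (hzero : ∀ᵐ y ∂m, ∀ᵐ z ∂m, d y z = 0 → f y = f z)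
    {Z : ℝ≥0∞} (hZ : ∫⁻ y, ∫⁻ z, dualOrlicz M (|f y - f z| / (d y z).toReal) ∂m ∂m ≤ Z)
include hM hball hfin hsymm htri hmin hf hzero hZ

/-- Points of concentric balls of radii r and 2r are within 3r, so a link costs at most 3r F(r) = 6
(r/2) F(r) ≤ 6 ∫ F over (r/2, r) for the antitone F. The intervals for r = R/2, R/4, … are disjoint.
-/
theorem meanDist_dirac_ballMean_le (x : X) {R : ℝ} (hR : 0 < R) (n : ℕ) :
    meanDist f (Measure.dirac x) (ballMean m d x R)
      ≤ meanDist f (Measure.dirac x) (ballMean m d x (R / 2 ^ n))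
        + 6 * ∫⁻ r in Set.Ioo (R / 2 ^ (n + 1)) (R / 2),
          orliczInv (dualOrlicz M) (4 * Z / minBall m d r ^ 2) := by
  induction n with
  | zero => simp
  | succ n ih =>
    set F := fun r => orliczInv (dualOrlicz M) (4 * Z / minBall m d r ^ 2) with hFdef
    have hF : Antitone F := antitone_orliczInv_div_minBall _ _
    set r := R / 2 ^ (n + 1) with hr
    have hr0 : 0 < r := by positivity
    have hrn : R / 2 ^ n = 2 * r := by rw [hr, pow_succ]; field_simp
    have hrn2 : R / 2 ^ (n + 1 + 1) = r / 2 := by rw [hr, pow_succ 2 (n + 1)]; field_simp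
    have hrR : r ≤ R / 2 := by
      rw [hr, pow_succ]
      exact div_le_div_of_nonneg_left hR.le two_pos
        (by linarith [one_le_pow₀ (M₀ := ℝ) one_le_two (n := n)])
    rw [hrn] at ih
    have := isProbabilityMeasure_ballMean (hmin r hr0) x
    have := isProbabilityMeasure_ballMean (hmin (2 * r) (by positivity)) x
    have hstep := meanDist_ballMean_le hM hball hfin hf hzero hZ (x₁ := x) (x₂ := x)
      (r₁ := r) (r₂ := 2 * r) (R := 3 * r) (hmin r hr0) (by linarith) (by positivity)
      (fun y z hy hz => by
        calc d y z ≤ d y x + d x z := htri _ _ _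
          _ ≤ ENNReal.ofReal r + ENNReal.ofReal (2 * r) := add_le_add (hsymm y x ▸ hy) hz
          _ = ENNReal.ofReal (3 * r) := by
              rw [← ENNReal.ofReal_add hr0.le (by positivity)]; congr 1; ring)
    have hlink : meanDist f (ballMean m d x r) (ballMean m d x (2 * r))
        ≤ 6 * (∫⁻ s in Set.Ioo (r / 2) r, F s) := by
      refine hstep.trans ?_
      calc ENNReal.ofReal (3 * r) * orliczInv (dualOrlicz M) (Z / minBall m d r ^ 2)
          ≤ ENNReal.ofReal (3 * r) * F r := by
            gcongr
            refine orliczInv_mono _ (ENNReal.div_le_div_right ?_ _)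
            exact le_mul_of_one_le_left zero_le (by norm_num)
        _ = 6 * (ENNReal.ofReal (r - r / 2) * F r) := by
            rw [← mul_assoc, ← ENNReal.ofReal_ofNat 6, ← ENNReal.ofReal_mul (by norm_num)]
            congr 2; ring
        _ ≤ _ := by gcongr; exact ofReal_mul_le_setLIntegral hF le_rfl
    have hunion := setLIntegral_Ioo_add_le F (half_le_self hr0.le) hrR
    rw [hrn2]
    calc meanDist f (Measure.dirac x) (ballMean m d x R)
        ≤ meanDist f (Measure.dirac x) (ballMean m d x (2 * r))
          + 6 * (∫⁻ s in Set.Ioo r (R / 2), F s) := ih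
      _ ≤ (meanDist f (Measure.dirac x) (ballMean m d x r)
            + meanDist f (ballMean m d x r) (ballMean m d x (2 * r)))
          + 6 * (∫⁻ s in Set.Ioo r (R / 2), F s) := by
          gcongr; exact meanDist_triangle hf _ _ _
      _ ≤ (meanDist f (Measure.dirac x) (ballMean m d x r)
            + 6 * ∫⁻ s in Set.Ioo (r / 2) r, F s)
          + 6 * (∫⁻ s in Set.Ioo r (R / 2), F s) := by gcongr
      _ = meanDist f (Measure.dirac x) (ballMean m d x r)
            + 6 * ((∫⁻ s in Set.Ioo (r / 2) r, F s) + ∫⁻ s in Set.Ioo r (R / 2), F s) := by ring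
      _ ≤ _ := by gcongr

/-- The Garsia-Rodemich-Rumsey inequality for a minorizing measure. -/
theorem ofReal_abs_sub_le_wBar {x₁ x₂ : X} (hd : d x₁ x₂ ≠ 0)
    (h₁ : ⨅ n : ℕ, meanDist f (Measure.dirac x₁)
      (ballMean m d x₁ ((d x₁ x₂).toReal / 2 ^ n)) = 0)
    (h₂ : ⨅ n : ℕ, meanDist f (Measure.dirac x₂)
      (ballMean m d x₂ ((d x₁ x₂).toReal / 2 ^ n)) = 0) :
    ENNReal.ofReal |f x₁ - f x₂| ≤ wBar m d (dualOrlicz M) x₁ x₂ Z := by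
  set R := (d x₁ x₂).toReal with hRdef
  have hR : 0 < R := ENNReal.toReal_pos hd (hfin _ _)
  have hdR : d x₁ x₂ = ENNReal.ofReal R := (ENNReal.ofReal_toReal (hfin _ _)).symm
  set F := fun r => orliczInv (dualOrlicz M) (4 * Z / minBall m d r ^ 2) with hFdef
  have hF : Antitone F := antitone_orliczInv_div_minBall _ _
  -- The chain bound holds for every n with the same integral over (0, R/2), so an infimum equal to
  -- 0 is enough and no limit is needed.
  have hinf : ∀ x, ⨅ n : ℕ, meanDist f (Measure.dirac x) (ballMean m d x (R / 2 ^ n)) = 0 →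
      meanDist f (Measure.dirac x) (ballMean m d x R) ≤ 6 * (∫⁻ r in Set.Ioo 0 (R / 2), F r) := by
    intro x hx
    rw [← zero_add (6 * _), ← hx, ENNReal.iInf_add]
    refine le_iInf fun n => ?_
    refine (meanDist_dirac_ballMean_le hM hball hfin hsymm htri hmin hf hzero hZ x hR n).trans ?_
    gcongr
    positivity
  have := isProbabilityMeasure_ballMean (hmin R hR) x₁
  have := isProbabilityMeasure_ballMean (hmin R hR) x₂
  -- The central link joins the balls of radius R = d(x₁,x₂) around the two points, whose elements
  -- are within 3R.
  have hstep := meanDist_ballMean_le hM hball hfin hf hzero hZ (x₁ := x₁) (x₂ := x₂)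
    (r₁ := R) (r₂ := R) (R := 3 * R) (hmin R hR) le_rfl (by positivity)
    (fun y z hy hz => by
      calc d y z ≤ d y x₁ + d x₁ z := htri _ _ _
        _ ≤ d y x₁ + (d x₁ x₂ + d x₂ z) := by gcongr; exact htri _ _ _
        _ ≤ ENNReal.ofReal R + (ENNReal.ofReal R + ENNReal.ofReal R) :=
            add_le_add (hsymm y x₁ ▸ hy) (add_le_add hdR.le hz)
        _ = ENNReal.ofReal (3 * R) := by
            rw [← ENNReal.ofReal_add hR.le hR.le, ← ENNReal.ofReal_add hR.le (by positivity)]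
            congr 1; ring)
  have hlink : meanDist f (ballMean m d x₁ R) (ballMean m d x₂ R)
      ≤ 6 * (∫⁻ s in Set.Ioo (R / 2) R, F s) := by
    refine hstep.trans ?_
    calc ENNReal.ofReal (3 * R) * orliczInv (dualOrlicz M) (Z / minBall m d R ^ 2)
        ≤ ENNReal.ofReal (3 * R) * F R := by
          gcongr
          refine orliczInv_mono _ (ENNReal.div_le_div_right ?_ _)
          exact le_mul_of_one_le_left zero_le (by norm_num)
      _ = 6 * (ENNReal.ofReal (R - R / 2) * F R) := by
          rw [← mul_assoc, ← ENNReal.ofReal_ofNat 6, ← ENNReal.ofReal_mul (by norm_num)]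
          congr 2; ring
      _ ≤ _ := by gcongr; exact ofReal_mul_le_setLIntegral hF le_rfl
  have hunion := setLIntegral_Ioo_add_le F (half_pos hR).le (half_le_self hR.le)
  rw [wBar_eq _ (hfin _ _), ← meanDist_dirac_dirac hf]
  calc meanDist f (Measure.dirac x₁) (Measure.dirac x₂)
      ≤ meanDist f (Measure.dirac x₁) (ballMean m d x₁ R)
        + (meanDist f (ballMean m d x₁ R) (ballMean m d x₂ R)
          + meanDist f (ballMean m d x₂ R) (Measure.dirac x₂)) :=
        (meanDist_triangle hf _ (ballMean m d x₁ R) _).trans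
          (add_le_add_right (meanDist_triangle hf _ (ballMean m d x₂ R) _) _)
    -- Two half-chains with coefficient 6 make 12 on (0, R/2). The central link has coefficient 6 on
    -- (R/2, R) and is raised to 12 to match.
    _ ≤ 6 * (∫⁻ r in Set.Ioo 0 (R / 2), F r)
        + (12 * (∫⁻ s in Set.Ioo (R / 2) R, F s) + 6 * ∫⁻ r in Set.Ioo 0 (R / 2), F r) := by
        rw [meanDist_comm hf (ballMean m d x₂ R)]
        refine add_le_add (hinf _ h₁) (add_le_add (hlink.trans ?_) (hinf _ h₂))
        gcongr
        norm_num
    _ = 12 * ((∫⁻ r in Set.Ioo 0 (R / 2), F r) + ∫⁻ s in Set.Ioo (R / 2) R, F s) := by ring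
    _ ≤ _ := by gcongr

end Chain

end Chaining

/-! ### Almost sure control of the increments of the field. -/

section Field

variable {X Ω : Type*} [MeasurableSpace X] [MeasurableSpace Ω] {P : Measure Ω}
  [IsProbabilityMeasure P] {m : Measure X} [IsProbabilityMeasure m] {M : ℝ → ℝ≥0∞}
  {ξ : X → Ω → ℝ} (hM : IsMoment M) (hmeas : Measurable (Function.uncurry ξ))
include hM hmeas

theorem measurable_zVar_integrand :
    Measurable fun p : Ω × (X × X) => dualOrlicz M (|ξ p.2.1 p.1 - ξ p.2.2 p.1|
      / (natDist P (dualOrlicz M) ξ p.2.1 p.2.2).toReal) := by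
  have h₁ : Measurable fun p : Ω × (X × X) => ξ p.2.1 p.1 :=
    hmeas.comp (measurable_snd.fst.prodMk measurable_fst)
  have h₂ : Measurable fun p : Ω × (X × X) => ξ p.2.2 p.1 :=
    hmeas.comp (measurable_snd.snd.prodMk measurable_fst)
  have h₃ : Measurable fun p : Ω × (X × X) => natDist P (dualOrlicz M) ξ p.2.1 p.2.2 :=
    (measurable_natDist (P := P) hM hmeas).comp measurable_snd
  exact hM.measurable_dualOrlicz.comp ((h₁.sub h₂).abs.div h₃.ennreal_toReal)

theorem zVar_eq_lintegral_prod (ω : Ω) :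
    zVar m (natDist P (dualOrlicz M) ξ) (dualOrlicz M) ξ ω
      = ∫⁻ p : X × X, dualOrlicz M (|ξ p.1 ω - ξ p.2 ω|
        / (natDist P (dualOrlicz M) ξ p.1 p.2).toReal) ∂(m.prod m) := by
  have h : Measurable fun p : X × X => dualOrlicz M (|ξ p.1 ω - ξ p.2 ω|
        / (natDist P (dualOrlicz M) ξ p.1 p.2).toReal) :=
    (measurable_zVar_integrand (P := P) hM hmeas).comp (f := fun p => (ω, p)) measurable_prodMk_left
  rw [zVar, lintegral_prod _ h.aemeasurable]

theorem measurable_zVar :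
    Measurable (zVar m (natDist P (dualOrlicz M) ξ) (dualOrlicz M) ξ) := by
  rw [funext (zVar_eq_lintegral_prod hM hmeas)]
  exact (measurable_zVar_integrand hM hmeas).lintegral_prod_right'

/-- By Tonelli the expectation may be taken for each pair of points, and there the attained
Luxemburg infimum gives at most 1. -/
theorem lintegral_zVar_le (hfin : ∀ x y, natDist P (dualOrlicz M) ξ x y ≠ ⊤) :
    ∫⁻ ω, zVar m (natDist P (dualOrlicz M) ξ) (dualOrlicz M) ξ ω ∂P ≤ 1 := by
  rw [funext (zVar_eq_lintegral_prod hM hmeas),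
    lintegral_lintegral_swap (measurable_zVar_integrand hM hmeas).aemeasurable]
  calc _ ≤ ∫⁻ _ : X × X, 1 ∂(m.prod m) := lintegral_mono fun p => ?_
    _ = 1 := by simp
  by_cases h0 : natDist P (dualOrlicz M) ξ p.1 p.2 = 0
  · simp [h0, hM.dualOrlicz_zero]
  · exact hM.lintegral_div_orliczNorm_le ((hmeas.of_uncurry_left).sub hmeas.of_uncurry_left)
      (ENNReal.toReal_pos h0 (hfin _ _)) (ENNReal.ofReal_toReal (hfin _ _)).ge

/-- The null set of ω depends on the pair; Fubini exchanges the quantifiers. Chaining needs this for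
the pairs that Z ignores. -/
theorem ae_ae_eq_of_natDist_eq_zero : ∀ᵐ ω ∂P, ∀ᵐ y ∂m, ∀ᵐ z ∂m,
    natDist P (dualOrlicz M) ξ y z = 0 → ξ y ω = ξ z ω := by
  have hset : MeasurableSet {q : (X × X) × Ω |
      natDist P (dualOrlicz M) ξ q.1.1 q.1.2 = 0 → ξ q.1.1 q.2 = ξ q.1.2 q.2} := by
    refine MeasurableSet.imp ?_ ?_
    · exact ((measurable_natDist (P := P) hM hmeas).comp measurable_fst) (measurableSet_singleton 0)
    · exact measurableSet_eq_fun (hmeas.comp (measurable_fst.fst.prodMk measurable_snd))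
        (hmeas.comp (measurable_fst.snd.prodMk measurable_snd))
  have h : ∀ᵐ q ∂(m.prod m), ∀ᵐ ω ∂P,
      natDist P (dualOrlicz M) ξ q.1 q.2 = 0 → ξ q.1 ω = ξ q.2 ω := by
    refine Eventually.of_forall fun q => ?_
    by_cases h0 : natDist P (dualOrlicz M) ξ q.1 q.2 = 0
    · filter_upwards [ae_eq_of_natDist_eq_zero hM (fun x => hmeas.of_uncurry_left) h0] with ω hω _
      exact hω
    · exact Eventually.of_forall fun ω h => absurd h h0
  filter_upwards [(Measure.ae_ae_comm hset).1 h] with ω hω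
  exact Measure.ae_ae_of_ae_prod hω

theorem measurableSet_natDist_ball (x : X) (r : ℝ) :
    MeasurableSet {y | natDist P (dualOrlicz M) ξ x y ≤ ENNReal.ofReal r} := by
  have h : Measurable fun y => natDist P (dualOrlicz M) ξ x y :=
    (measurable_natDist (P := P) hM hmeas).comp (f := fun y => (x, y)) measurable_prodMk_left
  exact measurableSet_le h measurable_const

/-- Along a sequence of radii the means over balls approximate the value at the centre. -/
theorem ae_iInf_meanDist_eq_zero
    (hmin : ∀ r, 0 < r → minBall m (natDist P (dualOrlicz M) ξ) r ≠ 0) (x : X) {R : ℝ}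
    (hR : 0 < R) :
    ∀ᵐ ω ∂P, ⨅ n : ℕ, meanDist (fun y => ξ y ω) (Measure.dirac x)
      (ballMean m (natDist P (dualOrlicz M) ξ) x (R / 2 ^ n)) = 0 := by
  set d := natDist P (dualOrlicz M) ξ with hd
  obtain ⟨C, hC, hle⟩ := hM.exists_lintegral_abs_le (P := P)
  have hpm : ∀ n : ℕ, IsProbabilityMeasure (ballMean m d x (R / 2 ^ n)) := fun n =>
    isProbabilityMeasure_ballMean (hmin _ (by positivity)) x
  have hF : Measurable fun p : Ω × X => ENNReal.ofReal |ξ x p.1 - ξ p.2 p.1| :=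
    ((hmeas.comp (measurable_const.prodMk measurable_fst)).sub
      (hmeas.comp (measurable_snd.prodMk measurable_fst))).abs.ennreal_ofReal
  have hrw : ∀ (n : ℕ) (ω : Ω), meanDist (fun y => ξ y ω) (Measure.dirac x)
      (ballMean m d x (R / 2 ^ n))
        = ∫⁻ z, ENNReal.ofReal |ξ x ω - ξ z ω| ∂(ballMean m d x (R / 2 ^ n)) := fun n ω =>
    meanDist_dirac hmeas.of_uncurry_right x _
  simp only [hrw]
  have hm : ∀ n : ℕ, Measurable fun ω =>
      ∫⁻ z, ENNReal.ofReal |ξ x ω - ξ z ω| ∂(ballMean m d x (R / 2 ^ n)) := fun n =>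
    hF.lintegral_prod_right'
  have hE : ∀ n : ℕ, ∫⁻ ω, ∫⁻ z, ENNReal.ofReal |ξ x ω - ξ z ω| ∂(ballMean m d x (R / 2 ^ n)) ∂P
      ≤ C * ENNReal.ofReal (R / 2 ^ n) := fun n => by
    rw [lintegral_lintegral_swap hF.aemeasurable]
    calc _ ≤ ∫⁻ _, C * ENNReal.ofReal (R / 2 ^ n) ∂(ballMean m d x (R / 2 ^ n)) := by
          refine lintegral_mono_ae ?_
          have : ∀ᵐ z ∂(ballMean m d x (R / 2 ^ n)), d x z ≤ ENNReal.ofReal (R / 2 ^ n) :=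
            ProbabilityTheory.ae_cond_mem (measurableSet_natDist_ball hM hmeas x _)
          filter_upwards [this] with z hz
          exact (hle _ ((hmeas.of_uncurry_left).sub hmeas.of_uncurry_left)).trans
            (mul_le_mul' le_rfl hz)
      _ = _ := by simp
  have hlim : Tendsto (fun n : ℕ => C * ENNReal.ofReal (R / 2 ^ n)) atTop (𝓝 0) := by
    have h1 : Tendsto (fun n : ℕ => R / 2 ^ n) atTop (𝓝 0) := by
      have := (tendsto_pow_atTop_nhds_zero_of_lt_one (r := (1 / 2 : ℝ)) (by norm_num)
        (by norm_num)).const_mul R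
      simpa [div_eq_mul_inv] using this
    have h2 := ENNReal.Tendsto.const_mul (a := C) (ENNReal.tendsto_ofReal h1) (Or.inr hC)
    simpa using h2
  -- The expectation of the infimum is at most the infimum of the expectations, which are O(R/2^n).
  have h0 : ∫⁻ ω, ⨅ n : ℕ, ∫⁻ z, ENNReal.ofReal |ξ x ω - ξ z ω|
      ∂(ballMean m d x (R / 2 ^ n)) ∂P = 0 := by
    refine le_antisymm (ge_of_tendsto' hlim fun n => ?_) zero_le
    exact (lintegral_mono fun ω => iInf_le _ n).trans (hE n)
  rw [lintegral_eq_zero_iff (Measurable.iInf hm)] at h0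
  exact h0

/-- The increments of the field are controlled by `w̄(x₁, x₂; Z)`. -/
theorem ae_ofReal_abs_sub_le_wBar (hfin : ∀ x y, natDist P (dualOrlicz M) ξ x y ≠ ⊤)
    (hmin : ∀ r, 0 < r → minBall m (natDist P (dualOrlicz M) ξ) r ≠ 0) (x₁ x₂ : X) :
    ∀ᵐ ω ∂P, ENNReal.ofReal |ξ x₁ ω - ξ x₂ ω| ≤ wBar m (natDist P (dualOrlicz M) ξ)
      (dualOrlicz M) x₁ x₂ (zVar m (natDist P (dualOrlicz M) ξ) (dualOrlicz M) ξ ω) := by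
  have hξ : ∀ x, Measurable (ξ x) := fun x => hmeas.of_uncurry_left
  by_cases hd : natDist P (dualOrlicz M) ξ x₁ x₂ = 0
  · filter_upwards [ae_eq_of_natDist_eq_zero hM hξ hd] with ω hω
    simp [hω]
  · have hR := ENNReal.toReal_pos hd (hfin _ _)
    filter_upwards [ae_iInf_meanDist_eq_zero hM hmeas hmin x₁ hR,
      ae_iInf_meanDist_eq_zero hM hmeas hmin x₂ hR,
      ae_ae_eq_of_natDist_eq_zero hM hmeas (m := m)] with ω h₁ h₂ hz
    exact ofReal_abs_sub_le_wBar hM (measurableSet_natDist_ball hM hmeas) hfin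
      (natDist_comm _) (natDist_triangle hM hξ) hmin hmeas.of_uncurry_right hz le_rfl hd h₁ h₂

end Field

/-! ### Consequences of the minorizing condition. -/

namespace IsMoment

variable {M : ℝ → ℝ≥0∞} (hM : IsMoment M)
include hM

/-- φ(l)/l is nondecreasing on the positive half-line, so linear growth persists once reached. -/
theorem eexp_le_of_le {a l₀ l : ℝ} (hl₀ : 0 < l₀) (ha : eexp (a * l₀) ≤ M l₀) (hl : l₀ ≤ l) :
    eexp (a * l) ≤ M l := by
  have hl0 : 0 < l := hl₀.trans_le hl
  have h1 := hM.map_mul_le (l₀ / l) l (by positivity) ((div_le_one hl0).2 hl)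
  rw [div_mul_cancel₀ _ hl0.ne'] at h1
  have h2 := ENNReal.rpow_le_rpow (ha.trans h1) (by positivity : 0 ≤ l / l₀)
  rw [eexp_rpow, ← ENNReal.rpow_mul, div_mul_div_comm, mul_comm l₀ l, div_self (by positivity),
    ENNReal.rpow_one] at h2
  convert h2 using 2
  field_simp

/-- The witness z = min(a, 1/l₀) works: beyond l₀ the linear growth of φ dominates lz, and below l₀
one has exp(lz) ≤ e ≤ 4 + 1. The argument 4 bounds 4V/h_-² from below at V = 1. -/
theorem orliczInv_four_pos {a l₀ : ℝ} (ha0 : 0 < a) (hl₀ : 0 < l₀) (ha : eexp (a * l₀) ≤ M l₀) :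
    0 < orliczInv (dualOrlicz M) 4 := by
  have hz : 0 < min a (1 / l₀) := by positivity
  refine (ENNReal.ofReal_pos.2 hz).trans_le (ofReal_le_orliczInv hz.le ?_)
  rw [dualOrlicz_le_iff]
  refine hM.expDual_le hz.le fun l hl => ?_
  rcases le_total l₀ l with h | h
  · calc eexp (l * min a (1 / l₀)) ≤ eexp (a * l) := by
          refine eexp_mono ?_
          rw [mul_comm a]
          exact mul_le_mul_of_nonneg_left (min_le_left _ _) hl
      _ ≤ M l := hM.eexp_le_of_le hl₀ ha h
      _ ≤ _ := le_mul_of_one_le_right zero_le le_add_self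
  · calc eexp (l * min a (1 / l₀)) ≤ eexp 1 := by
          refine eexp_mono ?_
          calc l * min a (1 / l₀) ≤ l₀ * (1 / l₀) :=
                mul_le_mul h (min_le_right _ _) hz.le hl₀.le
            _ = 1 := by field_simp
      _ ≤ ENNReal.ofReal 5 := ENNReal.ofReal_le_ofReal (by linarith [Real.exp_one_lt_d9])
      _ = 4 + 1 := by norm_num
      _ ≤ _ := le_mul_of_one_le_left zero_le (hM.one_le l)

end IsMoment

theorem le_diamOf {X : Type*} (d : X → X → ℝ≥0∞) (x y : X) : d x y ≤ diamOf d :=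
  le_iSup_of_le x (le_iSup_of_le y le_rfl)

section Minorizing

variable {X : Type*} [MeasurableSpace X] {m : Measure X} {d : X → X → ℝ≥0∞} {M : ℝ → ℝ≥0∞}

theorem wBar_le_gammaSup {Φ : ℝ → ℝ≥0∞} (x y : X) (V : ℝ≥0∞) :
    wBar m d Φ x y V ≤ gammaSup m d Φ V := le_iSup_of_le x (le_iSup_of_le y le_rfl)

theorem wBar_mono {Φ : ℝ → ℝ≥0∞} (x y : X) : Monotone (wBar m d Φ x y) := fun V W h => by
  refine mul_le_mul' le_rfl (lintegral_mono fun r => orliczInv_mono Φ ?_)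
  gcongr

theorem gammaSup_mono {Φ : ℝ → ℝ≥0∞} : Monotone (gammaSup m d Φ) := fun _ _ h =>
  iSup_mono fun x => iSup_mono fun y => wBar_mono x y h

section

variable (hM : IsMoment M)
include hM

/-- One pair at distance R > 0 controls all pairs: below R its own integral is finite, and above R
the antitone integrand is at most its value at R on an interval bounded by the diameter. -/
theorem gammaSup_one_lt_top (hfin : ∀ x y, d x y ≠ ⊤)
    (hmin : ∀ r, 0 < r → minBall m d r ≠ 0)
    (hw : ∀ x₁ x₂, wBar m d (dualOrlicz M) x₁ x₂ 1 < ⊤) (hdiam : diamOf d < ⊤) :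
    gammaSup m d (dualOrlicz M) 1 < ⊤ := by
  by_cases hd : ∀ x y, d x y = 0
  · simp [gammaSup, wBar, hd]
  push Not at hd
  obtain ⟨x, y, hxy⟩ := hd
  have hR : 0 < (d x y).toReal := ENNReal.toReal_pos hxy (hfin x y)
  set R := (d x y).toReal
  set F := fun r => orliczInv (dualOrlicz M) (4 * 1 / minBall m d r ^ 2) with hFdef
  have hF : Antitone F := antitone_orliczInv_div_minBall _ _
  have hFR : F R < ⊤ := hM.orliczInv_lt_top
    (ENNReal.div_ne_top (by norm_num) (pow_ne_zero 2 (hmin R hR)))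
  refine lt_of_le_of_lt (b := wBar m d (dualOrlicz M) x y 1
    + 12 * (F R * ENNReal.ofReal ((diamOf d).toReal - R))) ?_
    (ENNReal.add_lt_top.2 ⟨hw x y, ENNReal.mul_lt_top (by norm_num)
      (ENNReal.mul_lt_top hFR ENNReal.ofReal_lt_top)⟩)
  refine iSup_le fun x' => iSup_le fun y' => ?_
  rw [wBar_eq _ (hfin x' y'), wBar_eq _ (hfin x y), ← mul_add]
  refine mul_le_mul' le_rfl ?_
  have hsub : Set.Ioo 0 (d x' y').toReal ⊆ Set.Ioo 0 R ∪ Set.Icc R (diamOf d).toReal := by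
    intro r hr
    rcases lt_or_ge r R with h | h
    · exact Or.inl ⟨hr.1, h⟩
    · exact Or.inr ⟨h, hr.2.le.trans (ENNReal.toReal_mono hdiam.ne (le_diamOf d x' y'))⟩
  refine (lintegral_mono_set hsub).trans ((lintegral_union_le _ _ _).trans (add_le_add le_rfl ?_))
  calc ∫⁻ r in Set.Icc R (diamOf d).toReal, F r
      ≤ ∫⁻ _ in Set.Icc R (diamOf d).toReal, F R :=
        setLIntegral_mono' measurableSet_Icc fun r hr => hF hr.1
    _ = _ := by rw [setLIntegral_const, Real.volume_Icc]

/-- Subadditivity of Φ⁻¹ over products separates V from the r-dependent factor 4/h_-(r)². -/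
theorem gammaSup_le (hfin : ∀ x y, d x y ≠ ⊤) (V : ℝ≥0∞) :
    gammaSup m d (dualOrlicz M) V
      ≤ gammaSup m d (dualOrlicz M) 1 + 12 * diamOf d * orliczInv (dualOrlicz M) V := by
  refine iSup_le fun x => iSup_le fun y => ?_
  calc wBar m d (dualOrlicz M) x y V
      ≤ wBar m d (dualOrlicz M) x y 1 + 12 * (orliczInv (dualOrlicz M) V * d x y) := by
        rw [wBar_eq _ (hfin x y), wBar_eq _ (hfin x y), ← mul_add]
        refine mul_le_mul' le_rfl ?_
        calc ∫⁻ r in Set.Ioo 0 (d x y).toReal, orliczInv (dualOrlicz M) (4 * V / minBall m d r ^ 2)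
            ≤ ∫⁻ r in Set.Ioo 0 (d x y).toReal,
                (orliczInv (dualOrlicz M) (4 * 1 / minBall m d r ^ 2)
                  + orliczInv (dualOrlicz M) V) := by
              refine lintegral_mono fun r => ?_
              have : 4 * V / minBall m d r ^ 2 = 4 * 1 / minBall m d r ^ 2 * V := by
                rw [mul_one, ENNReal.mul_div_right_comm]
              rw [this]
              exact hM.orliczInv_mul_le _ _
          _ = _ := by
              rw [lintegral_add_right _ measurable_const, setLIntegral_const, Real.volume_Ioo,
                sub_zero, ENNReal.ofReal_toReal (hfin x y)]
    _ ≤ gammaSup m d (dualOrlicz M) 1 + 12 * (orliczInv (dualOrlicz M) V * diamOf d) := by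
        gcongr
        · exact wBar_le_gammaSup x y 1
        · exact le_diamOf d x y
    _ = _ := by ring

theorem wBar_zero (x y : X) : wBar m d (dualOrlicz M) x y 0 = 0 := by
  simp [wBar, hM.orliczInv_zero]

end

variable [IsProbabilityMeasure m]

theorem minBall_le_one [Nonempty X] (r : ℝ) : minBall m d r ≤ 1 :=
  (minBall_le (Classical.arbitrary X) r).trans prob_le_one

/-- If h_- vanished at r it would vanish on all of (0, r), where the integrand of w̄ would be Φ⁻¹(∞)
= ∞. When d is identically 0, every ball is the whole space. -/
theorem minBall_ne_zero [Nonempty X] {Φ : ℝ → ℝ≥0∞} (hfin : ∀ x y, d x y ≠ ⊤)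
    (hw : ∀ x₁ x₂, wBar m d Φ x₁ x₂ 1 < ⊤) {r : ℝ} (hr : 0 < r) : minBall m d r ≠ 0 := by
  intro h0
  by_cases hd : ∀ x y, d x y = 0
  · simp [minBall, hd] at h0
  · push Not at hd
    obtain ⟨x, y, hxy⟩ := hd
    have hR : 0 < (d x y).toReal := ENNReal.toReal_pos hxy (hfin x y)
    refine (hw x y).ne ?_
    rw [wBar_eq Φ (hfin x y)]
    refine ENNReal.mul_eq_top.2 (Or.inl ⟨by norm_num, ?_⟩)
    rw [eq_top_iff]
    have hF : ∫⁻ s in Set.Ioo 0 (min r (d x y).toReal),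
        orliczInv Φ (4 * 1 / minBall m d s ^ 2) = ⊤ := by
      have : ∫⁻ s in Set.Ioo 0 (min r (d x y).toReal),
          orliczInv Φ (4 * 1 / minBall m d s ^ 2)
          = ∫⁻ s in Set.Ioo 0 (min r (d x y).toReal), ⊤ := by
        refine setLIntegral_congr_fun measurableSet_Ioo fun s hs => ?_
        have h1 : minBall m d s = 0 :=
          le_antisymm (h0 ▸ minBall_mono (hs.2.le.trans (min_le_left _ _))) zero_le
        simp only [h1]
        rw [zero_pow two_ne_zero, ENNReal.div_zero (by norm_num), orliczInv_top]
      rw [this, setLIntegral_const, Real.volume_Ioo, sub_zero]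
      exact ENNReal.top_mul (by simp [hr, hR])
    rw [← hF]
    exact lintegral_mono_set (Set.Ioo_subset_Ioo_right (min_le_right _ _))

/-- At infinite distance w̄ integrates over (0, ∞) a function bounded below by Φ⁻¹(4) > 0, because
h_- ≤ 1. -/
theorem ne_top_of_wBar_lt_top [Nonempty X] {Φ : ℝ → ℝ≥0∞} {x y : X}
    (hΦ : 0 < orliczInv Φ 4) (hw : wBar m d Φ x y 1 < ⊤) : d x y ≠ ⊤ := by
  intro hd
  refine hw.ne ?_
  rw [wBar]
  refine ENNReal.mul_eq_top.2 (Or.inl ⟨by norm_num, ?_⟩)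
  rw [eq_top_iff]
  have hset : {r : ℝ | 0 < r ∧ ENNReal.ofReal r < d x y} = Set.Ioi 0 := by
    ext r; simp [hd]
  rw [hset]
  calc (⊤ : ℝ≥0∞) = ∫⁻ _ in Set.Ioi (0 : ℝ), orliczInv Φ 4 := by
        rw [setLIntegral_const, Real.volume_Ioi, ENNReal.mul_top hΦ.ne']
    _ ≤ _ := lintegral_mono fun r => orliczInv_mono Φ ?_
  rw [mul_one]
  calc (4 : ℝ≥0∞) = 4 / 1 := by simp
    _ ≤ _ := ENNReal.div_le_div_left (pow_le_one₀ zero_le (minBall_le_one r)) _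

/-- A large ball around x₀ has mass above 1 - h_-(1), so it meets every unit ball. Boundedness comes
from the measure. -/
theorem diamOf_lt_top [Nonempty X] (hball : ∀ x r, MeasurableSet {y | d x y ≤ ENNReal.ofReal r})
    (hfin : ∀ x y, d x y ≠ ⊤) (hsymm : ∀ x y, d x y = d y x)
    (htri : ∀ x y z, d x z ≤ d x y + d y z) (hmin : minBall m d 1 ≠ 0) : diamOf d < ⊤ := by
  let x₀ := Classical.arbitrary X
  have hmono : Monotone fun n : ℕ => {y | d x₀ y ≤ ENNReal.ofReal n} := fun i j hij y hy =>
    le_trans hy (ENNReal.ofReal_le_ofReal (by exact_mod_cast hij))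
  have hun : ⋃ n : ℕ, {y | d x₀ y ≤ ENNReal.ofReal n} = Set.univ := by
    refine Set.eq_univ_of_forall fun y => Set.mem_iUnion.2 ?_
    obtain ⟨n, hn⟩ := exists_nat_ge (d x₀ y).toReal
    exact ⟨n, (ENNReal.le_ofReal_iff_toReal_le (hfin _ _) (by positivity)).2 hn⟩
  have hlim := tendsto_measure_iUnion_atTop (μ := m) hmono
  rw [hun, measure_univ] at hlim
  have hlt : 1 - minBall m d 1 < 1 := ENNReal.sub_lt_self ENNReal.one_ne_top one_ne_zero hmin
  obtain ⟨n, hn⟩ := (hlim.eventually (lt_mem_nhds hlt)).exists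
  simp only [Function.comp_apply] at hn
  have hx : ∀ x, d x₀ x ≤ ENNReal.ofReal n + ENNReal.ofReal 1 := fun x => by
    by_contra! hlt'
    have hdisj : Disjoint {y | d x₀ y ≤ ENNReal.ofReal n} {y | d x y ≤ ENNReal.ofReal 1} := by
      refine Set.disjoint_left.2 fun y hy hy' => ?_
      refine hlt'.not_ge ((htri x₀ y x).trans (add_le_add hy ?_))
      rw [hsymm]
      exact hy'
    have h1 : m {y | d x₀ y ≤ ENNReal.ofReal n} + m {y | d x y ≤ ENNReal.ofReal 1} ≤ 1 := by
      rw [← measure_union hdisj (hball _ _)]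
      exact prob_le_one
    have h2 : 1 < m {y | d x₀ y ≤ ENNReal.ofReal n} + minBall m d 1 :=
      ENNReal.sub_lt_iff_lt_right ((minBall_le_one 1).trans_lt ENNReal.one_lt_top).ne
        (minBall_le_one 1) |>.1 hn
    exact absurd (h2.trans_le ((add_le_add le_rfl (minBall_le x 1)).trans h1)) (lt_irrefl _)
  refine lt_of_le_of_lt (b := (ENNReal.ofReal n + ENNReal.ofReal 1)
    + (ENNReal.ofReal n + ENNReal.ofReal 1)) (iSup_le fun x => iSup_le fun y => ?_) (by finiteness)
  exact (htri x x₀ y).trans (add_le_add (hsymm x x₀ ▸ hx x) (hx y))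

end Minorizing

/-! ### The semi-distance ζ. -/

section Zeta

variable {X : Type*} [MeasurableSpace X] {m : Measure X} {d : X → X → ℝ≥0∞}

theorem zeta_le_one (Φ : ℝ → ℝ≥0∞) (x y : X) : zeta m d Φ x y ≤ 1 :=
  iSup_le fun _ => iSup_le fun _ => ENNReal.div_le_of_le_mul (by
    rw [one_mul]; exact wBar_le_gammaSup x y _)

/-- For V > 0 and γ(V) > 0 this is one term of the supremum defining ζ. At V = 0 and at γ(V) = 0, w̄
itself vanishes. -/
theorem wBar_le_zeta_mul_gammaSup {M : ℝ → ℝ≥0∞} (hM : IsMoment M) (x y : X) {V : ℝ≥0∞}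
    (hV : V ≠ ⊤) (hγ : gammaSup m d (dualOrlicz M) V ≠ ⊤) :
    wBar m d (dualOrlicz M) x y V
      ≤ zeta m d (dualOrlicz M) x y * gammaSup m d (dualOrlicz M) V := by
  rcases eq_or_ne V 0 with rfl | hV0
  · rw [wBar_zero hM]; exact zero_le
  by_cases h0 : gammaSup m d (dualOrlicz M) V = 0
  · exact (wBar_le_gammaSup x y V).trans (h0.le.trans zero_le)
  · rw [← ENNReal.div_le_iff_le_mul (Or.inl h0) (Or.inl hγ)]
    have h : wBar m d (dualOrlicz M) x y (ENNReal.ofReal V.toReal)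
        / gammaSup m d (dualOrlicz M) (ENNReal.ofReal V.toReal) ≤ zeta m d (dualOrlicz M) x y :=
      le_iSup_of_le V.toReal (le_iSup_of_le (ENNReal.toReal_pos hV0 hV) le_rfl)
    rwa [ENNReal.ofReal_toReal hV] at h

end Zeta

/-! ### Union bound, Chernoff's bound and domination by M. -/

section Tail

variable {X Ω : Type*} [MeasurableSpace Ω] {P : Measure Ω} {M : ℝ → ℝ≥0∞}

theorem exists_cover_encard_le {ζ : X → X → ℝ≥0∞} {δ : ℝ} (h : coverNumber ζ δ ≠ ⊤) :
    ∃ T : Set X, (∀ x, ∃ s ∈ T, ζ x s ≤ ENNReal.ofReal δ) ∧ T.encard ≤ coverNumber ζ δ := by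
  have hlt : coverNumber ζ δ < coverNumber ζ δ + 1 := ENat.lt_add_one_iff h |>.2 le_rfl
  conv_lhs at hlt => rw [coverNumber]
  simp only [iInf_lt_iff] at hlt
  obtain ⟨T, hT, hlt⟩ := hlt
  exact ⟨T, hT, ENat.lt_add_one_iff h |>.1 hlt⟩

/-- The union bound over a minimal covering by balls. -/
theorem measure_lt_iSup_le {ξ : X → Ω → ℝ} {ζ : X → X → ℝ≥0∞} {θ : Ω → ℝ≥0∞} {u δ : ℝ}
    {S : Set X} (hδ : 0 < δ) (hS : S.Countable)
    (hsep : ∀ᵐ ω ∂P, ∀ x, u < ξ x ω → ∃ s ∈ S, u < ξ s ω)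
    (hinc : ∀ x y, ∀ᵐ ω ∂P, ENNReal.ofReal |ξ x ω - ξ y ω| ≤ ζ x y * θ ω)
    (hθ : ∀ᵐ ω ∂P, θ ω < ⊤) {q : ℝ≥0∞}
    (htail : ∀ x, P {ω | u < ξ x ω + δ * (θ ω).toReal} ≤ q) :
    P {ω | (u : EReal) < ⨆ x, (ξ x ω : EReal)} ≤ (coverNumber ζ δ : ℝ≥0∞) * q := by
  -- With an infinite cover the bound is ∞ unless q = 0, where it reads 0; then no point of the
  -- countable separant exceeds u almost surely.
  by_cases hN : coverNumber ζ δ = ⊤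
  · rcases eq_or_ne q 0 with rfl | hq
    · rw [mul_zero, nonpos_iff_eq_zero]
      have h : ∀ s ∈ S, ∀ᵐ ω ∂P, ¬ u < ξ s ω := fun s _ => by
        refine measure_mono_null (fun ω hω => ?_) (nonpos_iff_eq_zero.1 (htail s))
        have hω' : u < ξ s ω := not_not.1 hω
        exact hω'.trans_le (le_add_of_nonneg_right (by positivity))
      refine measure_eq_zero_iff_ae_notMem.2 ?_
      filter_upwards [hsep, (ae_ball_iff hS).2 h] with ω h1 h2 hω
      obtain ⟨x, hx⟩ := lt_iSup_iff.1 hω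
      obtain ⟨s, hs, hus⟩ := h1 x (by exact_mod_cast hx)
      exact h2 s hs hus
    · rw [hN, ENat.toENNReal_top, ENNReal.top_mul hq]
      exact le_top
  · obtain ⟨T, hT, hcard⟩ := exists_cover_encard_le hN
    have hfin : T.Finite := Set.encard_lt_top_iff.1 (hcard.trans_lt (lt_top_iff_ne_top.2 hN))
    -- The exceptional set of the increment bound depends on the pair, so x is first replaced by a
    -- point of the countable S.
    have hincST : ∀ᵐ ω ∂P, ∀ s ∈ S, ∀ t ∈ T, ENNReal.ofReal |ξ s ω - ξ t ω| ≤ ζ s t * θ ω :=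
      (ae_ball_iff hS).2 fun s _ => (ae_ball_iff hfin.countable).2 fun t _ => hinc s t
    have hsub : {ω | (u : EReal) < ⨆ x, (ξ x ω : EReal)}
        ≤ᵐ[P] ⋃ t ∈ hfin.toFinset, {ω | u < ξ t ω + δ * (θ ω).toReal} := by
      filter_upwards [hsep, hincST, hθ] with ω h1 h2 h3 hω
      obtain ⟨x, hx⟩ := lt_iSup_iff.1 hω
      obtain ⟨s, hs, hus⟩ := h1 x (by exact_mod_cast hx)
      obtain ⟨t, ht, hst⟩ := hT s
      refine Set.mem_iUnion₂.2 ⟨t, hfin.mem_toFinset.2 ht, ?_⟩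
      have h4 : |ξ s ω - ξ t ω| ≤ δ * (θ ω).toReal := by
        have := (h2 s hs t ht).trans (mul_le_mul' hst le_rfl)
        rw [← ENNReal.ofReal_toReal h3.ne, ← ENNReal.ofReal_mul hδ.le] at this
        exact (ENNReal.ofReal_le_ofReal_iff (by positivity)).1 this
      change u < ξ t ω + δ * (θ ω).toReal
      linarith [le_abs_self (ξ s ω - ξ t ω)]
    calc P {ω | (u : EReal) < ⨆ x, (ξ x ω : EReal)}
        ≤ P (⋃ t ∈ hfin.toFinset, {ω | u < ξ t ω + δ * (θ ω).toReal}) := measure_mono_ae hsub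
      _ ≤ ∑ t ∈ hfin.toFinset, P {ω | u < ξ t ω + δ * (θ ω).toReal} :=
          measure_biUnion_finset_le _ _
      _ ≤ ∑ _t ∈ hfin.toFinset, q := Finset.sum_le_sum fun t _ => htail t
      _ = (hfin.toFinset.card : ℝ≥0∞) * q := by rw [Finset.sum_const, nsmul_eq_mul]
      _ ≤ _ := by
          gcongr
          rw [hfin.encard_eq_coe_toFinset_card] at hcard
          have := ENat.toENNReal_le.2 hcard
          simpa using this

namespace IsMoment

variable (hM : IsMoment M)
include hM

/-- Chernoff's bound. -/
theorem measure_le_inv_expDual [IsProbabilityMeasure P] {W : Ω → ℝ} (hW : AEMeasurable W P)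
    {c v : ℝ} (hc : 0 < c) (hv : 0 ≤ v) (h : ∀ l, ∫⁻ ω, eexp (l * W ω) ∂P ≤ M (l * c)) :
    P {ω | v ≤ W ω} ≤ (expDual M (v / c))⁻¹ := by
  rw [ENNReal.le_inv_iff_le_inv]
  refine hM.expDual_le (by positivity) fun l hl => ?_
  rw [← div_eq_mul_inv, ENNReal.le_div_iff_mul_le (Or.inr (hM.ne_zero l))
    (Or.inl (measure_ne_top _ _))]
  have h1 := mul_meas_ge_le_lintegral₀ (μ := P) (f := fun ω => eexp (l / c * W ω))
    (measurable_eexp.comp_aemeasurable (hW.const_mul _)) (eexp (l * (v / c)))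
  refine le_trans ?_ (h1.trans ((h _).trans (le_of_eq (by rw [div_mul_cancel₀ _ hc.ne']))))
  refine mul_le_mul' le_rfl (measure_mono fun ω hω => ?_)
  refine eexp_mono ?_
  calc l * (v / c) = l / c * v := by ring
    _ ≤ l / c * W ω := mul_le_mul_of_nonneg_left hω (by positivity)

omit hM in
/-- The triangle inequality for the `B(φ)` norm. -/
theorem lintegral_eexp_add_le {f g : Ω → ℝ} (hf : AEMeasurable f P) (hg : AEMeasurable g P)
    {δ τ : ℝ} (hδ : 0 < δ) (hτ : 0 < τ) (h₁ : ∀ l, ∫⁻ ω, eexp (l * f ω) ∂P ≤ M l)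
    (h₂ : ∀ l, ∫⁻ ω, eexp (l * g ω) ∂P ≤ M (l * τ)) (l : ℝ) :
    ∫⁻ ω, eexp (l * (f ω + δ * g ω)) ∂P ≤ M (l * (1 + δ * τ)) := by
  set c := 1 + δ * τ with hc
  have hc0 : 0 < c := by positivity
  -- The Hölder weights 1/c and δτ/c are chosen so that both factors are bounded by powers of the
  -- same M(lc).
  have hH := ENNReal.lintegral_mul_norm_pow_le (μ := P) (f := fun ω => eexp (l * c * f ω))
    (g := fun ω => eexp (l * c / τ * g ω)) (p := 1 / c) (q := δ * τ / c)
    (measurable_eexp.comp_aemeasurable (hf.const_mul _))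
    (measurable_eexp.comp_aemeasurable (hg.const_mul _)) (by positivity) (by positivity)
    (by rw [← add_div, ← hc, div_self hc0.ne'])
  calc ∫⁻ ω, eexp (l * (f ω + δ * g ω)) ∂P
      = ∫⁻ ω, eexp (l * c * f ω) ^ (1 / c) * eexp (l * c / τ * g ω) ^ (δ * τ / c) ∂P := by
        refine lintegral_congr fun ω => ?_
        rw [eexp_rpow, eexp_rpow, ← eexp_add]
        congr 1
        field_simp
    _ ≤ _ := hH
    _ ≤ M (l * c) ^ (1 / c) * M (l * c) ^ (δ * τ / c) := by
        gcongr
        · exact h₁ _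
        · refine (h₂ _).trans (le_of_eq ?_)
          rw [div_mul_cancel₀ _ hτ.ne']
    _ = M (l * c) := by
        rw [← ENNReal.rpow_add_of_nonneg _ _ (by positivity) (by positivity), ← add_div, ← hc,
          div_self hc0.ne', ENNReal.rpow_one]

theorem pow_le (n : ℕ) (x : ℝ) : M x ^ (n + 1) ≤ M (((n : ℝ) + 1) * x) := by
  have hn : (0 : ℝ) < (n : ℝ) + 1 := by positivity
  have h := hM.map_mul_le (1 / ((n : ℝ) + 1)) (((n : ℝ) + 1) * x) (by positivity)
    ((div_le_one hn).2 (by linarith [Nat.cast_nonneg (α := ℝ) n]))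
  rw [← mul_assoc, one_div_mul_cancel hn.ne', one_mul] at h
  have h2 := ENNReal.rpow_le_rpow h hn.le
  rw [← ENNReal.rpow_mul, one_div_mul_cancel hn.ne', ENNReal.rpow_one] at h2
  rw [← ENNReal.rpow_natCast]
  push_cast
  exact h2

/-- A criterion for the finiteness of the `B(φ)` norm. -/
theorem exists_lintegral_eexp_le {η : Ω → ℝ} {σ L C A B : ℝ} (hσ : 0 < σ)
    (hMσ : ∀ l, ENNReal.ofReal (1 + σ * l ^ 2) ≤ M l) (hL : 0 < L)
    (hB : 0 ≤ B)
    (hsmall : ∀ l, |l| ≤ L → ∫⁻ ω, eexp (l * η ω) ∂P ≤ ENNReal.ofReal (1 + C * l ^ 2))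
    (hlarge : ∀ l, ∫⁻ ω, eexp (l * η ω) ∂P ≤ eexp (|l| * A) * (2 * M (|l| * B))) :
    ∃ τ : ℝ, 0 < τ ∧ ∀ l, ∫⁻ ω, eexp (l * η ω) ∂P ≤ M (l * τ) := by
  set s := max B 1 with hs
  have hs1 : 1 ≤ s := le_max_right _ _
  have hs0 : 0 < s := by linarith
  have hsL : 0 < s * L := by positivity
  -- The slope of φ guaranteed at sL by the quadratic lower bound; it persists to the right of sL.
  set a := Real.log (1 + σ * (s * L) ^ 2) / (s * L) with ha
  have ha0 : 0 < a := div_pos (Real.log_pos (by linarith [show 0 < σ * (s * L) ^ 2 by positivity]))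
    hsL
  have haM : eexp (a * (s * L)) ≤ M (s * L) := by
    rw [ha, div_mul_cancel₀ _ hsL.ne']
    simp only [eexp]
    rw [Real.exp_log (by positivity)]
    exact hMσ _
  -- For |l| ≥ L, 2 ≤ exp(|l|/L), so n factors M(s|l|) absorb 2 exp(|l|A) and one more absorbs
  -- M(|l|B). For |l| ≤ L, C ≤ nσ compares the quadratic terms.
  obtain ⟨n, hn⟩ := exists_nat_ge (max ((A + 1 / L) / (a * s)) (C / σ))
  have hn1 : A + 1 / L ≤ n * (a * s) :=
    (div_le_iff₀ (by positivity)).1 ((le_max_left _ _).trans hn)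
  have hn2 : C ≤ n * σ := (div_le_iff₀ hσ).1 ((le_max_right _ _).trans hn)
  have hn0 : (0 : ℝ) ≤ n := Nat.cast_nonneg n
  refine ⟨((n : ℝ) + 1) * s, by positivity, fun l => ?_⟩
  rcases le_total |l| L with hl | hl
  · refine (hsmall l hl).trans (le_trans (ENNReal.ofReal_le_ofReal ?_) (hMσ _))
    have h1 : C ≤ σ * (((n : ℝ) + 1) * s) ^ 2 := by
      have h2 : (n : ℝ) ≤ (((n : ℝ) + 1) * s) ^ 2 := by
        have h3 : (n : ℝ) + 1 ≤ ((n : ℝ) + 1) * s := le_mul_of_one_le_right (by positivity) hs1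
        nlinarith
      nlinarith
    have := mul_le_mul_of_nonneg_right h1 (sq_nonneg l)
    calc 1 + C * l ^ 2 ≤ 1 + σ * (((n : ℝ) + 1) * s) ^ 2 * l ^ 2 := by linarith
      _ = _ := by ring
  · have hl0 : 0 < |l| := hL.trans_le hl
    refine (hlarge l).trans ?_
    have h1 : eexp (a * (s * |l|)) ≤ M (s * |l|) :=
      hM.eexp_le_of_le hsL haM (mul_le_mul_of_nonneg_left hl hs0.le)
    have h2 : M (|l| * B) ≤ M (s * |l|) := by
      refine hM.mono ?_
      rw [abs_mul, abs_mul, abs_abs, abs_of_nonneg hB, abs_of_pos hs0, mul_comm]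
      exact mul_le_mul_of_nonneg_right (le_max_left _ _) hl0.le
    have h3 : eexp (|l| * A) * 2 ≤ M (s * |l|) ^ n := by
      calc eexp (|l| * A) * 2 ≤ eexp (|l| * A) * eexp (|l| / L) := by
            gcongr
            calc (2 : ℝ≥0∞) = ENNReal.ofReal 2 := by simp
              _ ≤ eexp (|l| / L) := ENNReal.ofReal_le_ofReal (by
                  have := Real.add_one_le_exp (|l| / L)
                  have h5 : 1 ≤ |l| / L := (one_le_div hL).2 hl
                  linarith)
        _ = eexp (|l| * (A + 1 / L)) := by rw [← eexp_add]; congr 1; ring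
        _ ≤ eexp ((n : ℝ) * (a * (s * |l|))) := by
            refine eexp_mono ?_
            calc |l| * (A + 1 / L) ≤ |l| * (n * (a * s)) := mul_le_mul_of_nonneg_left hn1 hl0.le
              _ = _ := by ring
        _ = eexp (a * (s * |l|)) ^ n := by rw [← eexp_rpow, ENNReal.rpow_natCast]
        _ ≤ _ := by gcongr
    calc eexp (|l| * A) * (2 * M (|l| * B)) = eexp (|l| * A) * 2 * M (|l| * B) := by ring
      _ ≤ M (s * |l|) ^ n * M (s * |l|) := mul_le_mul' h3 h2
      _ = M (s * |l|) ^ (n + 1) := (pow_succ _ _).symm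
      _ ≤ M (((n : ℝ) + 1) * (s * |l|)) := hM.pow_le n _
      _ = M (l * (((n : ℝ) + 1) * s)) := by
          rw [← hM.map_abs (l * _), abs_mul, abs_of_pos (show 0 < ((n : ℝ) + 1) * s by positivity)]
          congr 1; ring

end IsMoment

end Tail

/-! ### Exponential moments of θ = γ(Z). -/

section Theta

variable {X Ω : Type*} [MeasurableSpace X] [MeasurableSpace Ω] {P : Measure Ω}
  [IsProbabilityMeasure P] {m : Measure X} {d : X → X → ℝ≥0∞} {M : ℝ → ℝ≥0∞}
  (hM : IsMoment M)

include hM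

theorem gammaSup_lt_top (hfin : ∀ x y, d x y ≠ ⊤) (hdiam : diamOf d < ⊤)
    (hγ : gammaSup m d (dualOrlicz M) 1 < ⊤) {V : ℝ≥0∞} (hV : V ≠ ⊤) :
    gammaSup m d (dualOrlicz M) V < ⊤ :=
  (gammaSup_le hM hfin V).trans_lt (ENNReal.add_lt_top.2 ⟨hγ, ENNReal.mul_lt_top
    (ENNReal.mul_lt_top (by norm_num) hdiam) (hM.orliczInv_lt_top hV)⟩)

/-- Exponential moments of `γ(Z)`. -/
theorem lintegral_eexp_gammaSup_le (hfin : ∀ x y, d x y ≠ ⊤) (hdiam : diamOf d < ⊤)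
    (hγ : gammaSup m d (dualOrlicz M) 1 < ⊤) {Z : Ω → ℝ≥0∞}
    (hEZ : ∫⁻ ω, Z ω ∂P ≤ 1) {l : ℝ} (hl : 0 ≤ l) :
    ∫⁻ ω, eexp (l * (gammaSup m d (dualOrlicz M) (Z ω)).toReal) ∂P
      ≤ eexp (l * (gammaSup m d (dualOrlicz M) 1).toReal)
        * (2 * M (l * (12 * (diamOf d).toReal))) := by
  set A := (gammaSup m d (dualOrlicz M) 1).toReal
  set B := 12 * (diamOf d).toReal with hB
  have hB0 : 0 ≤ B := by positivity
  have hpt : ∀ ω, eexp (l * (gammaSup m d (dualOrlicz M) (Z ω)).toReal)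
      ≤ eexp (l * A) * M (l * B) * (Z ω + 1) := fun ω => by
    rcases eq_or_ne (Z ω) ⊤ with h | h
    · rw [h, top_add, ENNReal.mul_top (mul_ne_zero (eexp_ne_zero _) (hM.ne_zero _))]
      exact le_top
    have h1 : (gammaSup m d (dualOrlicz M) (Z ω)).toReal
        ≤ A + B * (orliczInv (dualOrlicz M) (Z ω)).toReal := by
      have hlt : 12 * diamOf d * orliczInv (dualOrlicz M) (Z ω) ≠ ⊤ := (ENNReal.mul_lt_top
        (ENNReal.mul_lt_top (by norm_num) hdiam) (hM.orliczInv_lt_top h)).ne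
      have := ENNReal.toReal_mono (ENNReal.add_ne_top.2 ⟨hγ.ne, hlt⟩) (gammaSup_le hM hfin (Z ω))
      rw [ENNReal.toReal_add hγ.ne hlt, ENNReal.toReal_mul, ENNReal.toReal_mul] at this
      simpa using this
    calc eexp (l * (gammaSup m d (dualOrlicz M) (Z ω)).toReal)
        ≤ eexp (l * A + l * B * (orliczInv (dualOrlicz M) (Z ω)).toReal) :=
          eexp_mono (by nlinarith)
      _ = eexp (l * A) * eexp (l * B * (orliczInv (dualOrlicz M) (Z ω)).toReal) := eexp_add _ _
      _ ≤ eexp (l * A) * (M (l * B) * (Z ω + 1)) := by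
          gcongr
          exact hM.eexp_mul_orliczInv_le (by positivity) _
      _ = _ := (mul_assoc _ _ _).symm
  rcases eq_or_ne (M (l * B)) ⊤ with h | h
  · rw [h, ENNReal.mul_top two_ne_zero, ENNReal.mul_top (eexp_ne_zero _)]
    exact le_top
  calc _ ≤ ∫⁻ ω, eexp (l * A) * M (l * B) * (Z ω + 1) ∂P := lintegral_mono hpt
    _ = eexp (l * A) * M (l * B) * (∫⁻ ω, Z ω ∂P + 1) := by
        rw [lintegral_const_mul' _ _ (ENNReal.mul_ne_top (eexp_ne_top _) h),
          lintegral_add_right _ measurable_const]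
        simp
    _ ≤ eexp (l * A) * M (l * B) * (1 + 1) := by gcongr
    _ = _ := by rw [one_add_one_eq_two]; ring

/-- The mean of `γ(Z)` is finite and the centred variable has exponential moments dominated
by `M`. -/
theorem exists_bound_gammaSup (hfin : ∀ x y, d x y ≠ ⊤) (hdiam : diamOf d < ⊤)
    (hγ : gammaSup m d (dualOrlicz M) 1 < ⊤) {Z : Ω → ℝ≥0∞} (hZm : Measurable Z)
    (hEZ : ∫⁻ ω, Z ω ∂P ≤ 1) :
    ∫⁻ ω, gammaSup m d (dualOrlicz M) (Z ω) ∂P < ⊤ ∧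
    ∀ σ : ℝ, 0 < σ → (∀ l, ENNReal.ofReal (1 + σ * l ^ 2) ≤ M l) →
      ∃ τ : ℝ, 0 < τ ∧ ∀ l, ∫⁻ ω, eexp (l * ((gammaSup m d (dualOrlicz M) (Z ω)).toReal
        - (∫⁻ ω', gammaSup m d (dualOrlicz M) (Z ω') ∂P).toReal)) ∂P ≤ M (l * τ) := by
  set θ : Ω → ℝ≥0∞ := fun ω => gammaSup m d (dualOrlicz M) (Z ω) with hθ
  have hθm : Measurable θ := gammaSup_mono.measurable.comp hZm
  have hθfin : ∀ᵐ ω ∂P, θ ω < ⊤ := by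
    filter_upwards [ae_lt_top hZm (hEZ.trans_lt ENNReal.one_lt_top).ne] with ω hω
    exact gammaSup_lt_top hM hfin hdiam hγ hω.ne
  set A := (gammaSup m d (dualOrlicz M) 1).toReal
  set B := 12 * (diamOf d).toReal with hB
  have hB0 : 0 ≤ B := by positivity
  have hexp : ∀ l, 0 ≤ l → ∫⁻ ω, eexp (l * (θ ω).toReal) ∂P ≤ eexp (l * A) * (2 * M (l * B)) :=
    fun l hl => lintegral_eexp_gammaSup_le hM hfin hdiam hγ hEZ hl
  obtain ⟨L₀, hL₀, hML₀⟩ := hM.exists_lt_top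
  obtain ⟨L, hL, hML⟩ : ∃ L : ℝ, 0 < L ∧ ∫⁻ ω, eexp (L * (θ ω).toReal) ∂P < ⊤ := by
    -- Dividing by B + 1 keeps LB ≤ L₀, inside the range where M is finite, even when B = 0.
    refine ⟨L₀ / (B + 1), by positivity, (hexp _ (by positivity)).trans_lt ?_⟩
    refine ENNReal.mul_lt_top (eexp_ne_top _).lt_top (ENNReal.mul_lt_top (by norm_num)
      ((hM.mono ?_).trans_lt hML₀))
    rw [abs_of_nonneg (by positivity), abs_of_pos hL₀, div_mul_eq_mul_div,
      div_le_iff₀ (by positivity)]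
    nlinarith
  have hEθ : ∫⁻ ω, θ ω ∂P < ⊤ := by
    have h1 : ENNReal.ofReal L * ∫⁻ ω, θ ω ∂P ≤ ∫⁻ ω, eexp (L * (θ ω).toReal) ∂P := by
      rw [← lintegral_const_mul _ hθm]
      refine lintegral_mono_ae ?_
      filter_upwards [hθfin] with ω hω
      conv_lhs => rw [← ENNReal.ofReal_toReal hω.ne]
      rw [← ENNReal.ofReal_mul hL.le]
      exact ENNReal.ofReal_le_ofReal (by linarith [Real.add_one_le_exp (L * (θ ω).toReal)])
    by_contra h
    rw [not_lt, top_le_iff] at h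
    rw [h, ENNReal.mul_top (by simpa using hL)] at h1
    exact absurd hML h1.not_gt
  refine ⟨hEθ, fun σ hσ hMσ => ?_⟩
  set e := (∫⁻ ω, θ ω ∂P).toReal with he
  have he0 : 0 ≤ e := ENNReal.toReal_nonneg
  have hθi : Integrable (fun ω => (θ ω).toReal) P :=
    integrable_toReal_of_lintegral_ne_top hθm.aemeasurable hEθ.ne
  have hηi : Integrable (fun ω => (θ ω).toReal - e) P := hθi.sub (integrable_const e)
  have hη0 : ∫ ω, ((θ ω).toReal - e) ∂P = 0 := by
    rw [integral_sub hθi (integrable_const e), integral_toReal hθm.aemeasurable hθfin]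
    simp [he]
  have habs : ∀ ω, |(θ ω).toReal - e| ≤ e + (θ ω).toReal := fun ω => by
    have : 0 ≤ (θ ω).toReal := ENNReal.toReal_nonneg
    rw [abs_le]; constructor <;> linarith
  have hηexp : ∀ l, 0 ≤ l → ∫⁻ ω, eexp (l * |(θ ω).toReal - e|) ∂P
      ≤ eexp (l * e) * ∫⁻ ω, eexp (l * (θ ω).toReal) ∂P := fun l hl => by
    rw [← lintegral_const_mul' _ _ (eexp_ne_top _)]
    refine lintegral_mono fun ω => ?_
    rw [← eexp_add, ← mul_add]
    exact eexp_mono (mul_le_mul_of_nonneg_left (habs ω) hl)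
  have hBt : eexp (L * e) * ∫⁻ ω, eexp (L * (θ ω).toReal) ∂P ≠ ⊤ :=
    ENNReal.mul_ne_top (eexp_ne_top _) hML.ne
  refine hM.exists_lintegral_eexp_le (L := L / 2)
    (C := 8 * (eexp (L * e) * ∫⁻ ω, eexp (L * (θ ω).toReal) ∂P).toReal / L ^ 2) (A := A + e)
    (B := B) hσ hMσ (by positivity) hB0 (fun l hl => ?_)
    (fun l => ?_)
  · refine lintegral_eexp_le_quad hηi hη0 hL ENNReal.toReal_nonneg ?_ hl
    rw [ENNReal.ofReal_toReal hBt]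
    exact hηexp L hL.le
  · calc ∫⁻ ω, eexp (l * ((θ ω).toReal - e)) ∂P
        ≤ ∫⁻ ω, eexp (|l| * |(θ ω).toReal - e|) ∂P := lintegral_mono fun ω => eexp_mono (by
          rw [← abs_mul]; exact le_abs_self _)
      _ ≤ eexp (|l| * e) * ∫⁻ ω, eexp (|l| * (θ ω).toReal) ∂P := hηexp _ (abs_nonneg l)
      _ ≤ eexp (|l| * e) * (eexp (|l| * A) * (2 * M (|l| * B))) := by
          gcongr
          exact hexp _ (abs_nonneg l)
      _ = _ := by rw [← mul_assoc, ← eexp_add]; congr 2; ring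

end Theta

/-! ### Threshold arithmetic and the B(φ) norm. -/

/-- The origin of u₀: write e² = (K - b)(K + b) and use (K + b)(1 + Kδ) < 2K(1 + K) ≤ ue. -/
theorem lt_sub_div_of_threshold {b e K u δ : ℝ} (hb : 0 ≤ b) (he : 0 < e) (hK0 : 0 ≤ K)
    (hK : K ^ 2 = b ^ 2 + e ^ 2) (hu : 0 < u) (hth : 2 * K * (1 + K) ≤ u * e) (hδ1 : δ < 1) :
    b < K - e * (1 + K * δ) / u := by
  have hbK : b < K := by nlinarith
  have hKpos : 0 < K := hb.trans_lt hbK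
  rw [lt_sub_comm, div_lt_iff₀ hu]
  have h1 : e ^ 2 = (K - b) * (K + b) := by linarith
  have h2 : e * (e * (1 + K * δ)) < e * ((K - b) * u) := by
    calc e * (e * (1 + K * δ)) = (K - b) * ((K + b) * (1 + K * δ)) := by
          rw [← mul_assoc, ← pow_two, h1]; ring
      _ < (K - b) * (2 * K * (1 + K)) := by
          refine mul_lt_mul_of_pos_left ?_ (sub_pos.2 hbK)
          have h3 : K * δ < K := by nlinarith
          nlinarith
      _ ≤ (K - b) * (u * e) := mul_le_mul_of_nonneg_left hth (sub_pos.2 hbK).le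
      _ = _ := by ring
  exact lt_of_mul_lt_mul_left h2 he.le

/-- Clearing denominators turns the conclusion into the non-strict form of the bound assumed on τ.
-/
theorem div_le_div_of_lt_sub_div {e K u δ τ : ℝ} (hK0 : 0 ≤ K) (hu : 0 < u) (hδ : 0 < δ)
    (hτ0 : 0 < τ) (hτ : τ < K - e * (1 + K * δ) / u) :
    u / (1 + K * δ) ≤ (u - δ * e) / (1 + δ * τ) := by
  rw [lt_sub_comm, div_lt_iff₀ hu] at hτ
  rw [div_le_div_iff₀ (by positivity) (by positivity)]
  nlinarith

section Norm

variable {Ω : Type*} [MeasurableSpace Ω] {P : Measure Ω} {M : ℝ → ℝ≥0∞} {η : Ω → ℝ}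

theorem exp_log_apply (M : ℝ → ℝ≥0∞) (l : ℝ) :
    EReal.exp ((fun l => ENNReal.log (M l)) l) = M l := ENNReal.exp_log _

theorem bNorm_le {τ : ℝ} (hτ : 0 < τ) (h : ∀ l, ∫⁻ ω, eexp (l * η ω) ∂P ≤ M (l * τ)) :
    bNorm P (fun l => ENNReal.log (M l)) η ≤ ENNReal.ofReal τ :=
  iInf_le_of_le τ (iInf_le_of_le hτ (iInf_le_of_le (fun l => by
    rw [exp_log_apply]; exact h l) le_rfl))

theorem exists_of_bNorm_lt {t : ℝ} (h : bNorm P (fun l => ENNReal.log (M l)) η < ENNReal.ofReal t) :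
    ∃ τ : ℝ, 0 < τ ∧ τ < t ∧ ∀ l, ∫⁻ ω, eexp (l * η ω) ∂P ≤ M (l * τ) := by
  simp only [bNorm, iInf_lt_iff] at h
  obtain ⟨τ, hτ, hle, hlt⟩ := h
  refine ⟨τ, hτ, (ENNReal.ofReal_lt_ofReal_iff_of_nonneg hτ.le).1 hlt, fun l => ?_⟩
  have := hle l
  rwa [exp_log_apply] at this

theorem bNorm_eq_zero_of_ae_eq_zero [IsProbabilityMeasure P] (hM : IsMoment M) (h : η =ᵐ[P] 0) :
    bNorm P (fun l => ENNReal.log (M l)) η = 0 := by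
  refine le_antisymm (ENNReal.le_of_forall_pos_le_add fun ε hε _ => ?_) zero_le
  rw [zero_add, ← ENNReal.ofReal_coe_nnreal]
  refine bNorm_le hε fun l => ?_
  have : ∫⁻ ω, eexp (l * η ω) ∂P = 1 := by
    rw [lintegral_congr_ae (g := fun _ => (1 : ℝ≥0∞))]
    · simp
    · filter_upwards [h] with ω hω
      simp [hω, eexp]
  rw [this]
  exact hM.one_le _

end Norm

/-! ### Assembly of the tail estimate. -/

section Main

variable {X Ω : Type*} [MeasurableSpace Ω] {P : Measure Ω} {ξ : X → Ω → ℝ}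

/-- A nondegenerate field has a natural function bounded from below by a quadratic function. -/
theorem exists_one_add_sq_le_momentSup [IsProbabilityMeasure P] (hξ : ∀ x, Measurable (ξ x))
    (heven : ∀ l, naturalFunction P ξ (-l) = naturalFunction P ξ l)
    {x : X} (hx : ¬ ξ x =ᵐ[P] 0) :
    ∃ σ : ℝ, 0 < σ ∧ ∀ l, ENNReal.ofReal (1 + σ * l ^ 2) ≤ momentSup P ξ l := by
  have hs : ∫⁻ ω, ENNReal.ofReal (ξ x ω ^ 2) ∂P ≠ 0 := by
    intro h
    rw [lintegral_eq_zero_iff ((hξ x).pow_const 2).ennreal_ofReal] at h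
    refine hx ?_
    filter_upwards [h] with ω hω
    simp only [Pi.zero_apply, ENNReal.ofReal_eq_zero] at hω ⊢
    nlinarith [sq_nonneg (ξ x ω)]
  obtain ⟨c, hc0, hc⟩ := ENNReal.lt_iff_exists_nnreal_btwn.1 (pos_iff_ne_zero.2 hs)
  have hc0' : (0 : ℝ) < c := by exact_mod_cast hc0
  refine ⟨c / 4, by positivity, fun l => le_trans ?_ (one_add_sq_le_momentSup hξ heven x l)⟩
  calc ENNReal.ofReal (1 + c / 4 * l ^ 2) = 1 + ENNReal.ofReal (l ^ 2 / 4) * c := by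
        rw [← ENNReal.ofReal_coe_nnreal, ← ENNReal.ofReal_mul (by positivity),
          ← ENNReal.ofReal_one, ← ENNReal.ofReal_add zero_le_one (by positivity)]
        congr 1; ring
    _ ≤ _ := by gcongr

/-- Separability reduces the exceedance of a level by `F(ξ)`, `F` continuous, to a countable set. -/
theorem IsSeparableField.exists_countable [TopologicalSpace X] (h : IsSeparableField P ξ) :
    ∃ S : Set X, S.Countable ∧ ∀ F : ℝ → ℝ, Continuous F → ∀ u : ℝ,
      ∀ᵐ ω ∂P, ∀ x, u < F (ξ x ω) → ∃ s ∈ S, u < F (ξ s ω) := by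
  obtain ⟨S, hS, hcl⟩ := h
  refine ⟨S, hS, fun F hF u => ?_⟩
  filter_upwards [hcl] with ω hω x hx
  have hopen : IsOpen {p : X × ℝ | u < F p.2} :=
    isOpen_lt continuous_const (hF.comp continuous_snd)
  obtain ⟨p, hp, s, hs, rfl⟩ := mem_closure_iff.1 (hω x) _ hopen hx
  exact ⟨s, hs, hp⟩

/-- The tail estimate for one of the fields `ξ`, `-ξ`. -/
theorem measure_lt_iSup_le_entropy [IsProbabilityMeasure P] {M : ℝ → ℝ≥0∞} (hM : IsMoment M)
    (hξ : ∀ x, Measurable (ξ x)) (hmom : ∀ x l, ∫⁻ ω, eexp (l * ξ x ω) ∂P ≤ M l)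
    {ζ : X → X → ℝ≥0∞} (hζ : ∀ x y, ζ x y ≤ 1)
    {θ : Ω → ℝ≥0∞} (hθ : Measurable θ) (hθe : ∫⁻ ω, θ ω ∂P ≠ ⊤)
    (hinc : ∀ x y, ∀ᵐ ω ∂P, ENNReal.ofReal |ξ x ω - ξ y ω| ≤ ζ x y * θ ω)
    {u : ℝ} (hu : 0 < u) {S : Set X} (hS : S.Countable)
    (hsep : ∀ᵐ ω ∂P, ∀ x, u < ξ x ω → ∃ s ∈ S, u < ξ s ω)
    {b : ℝ≥0∞} (hb : b = bNorm P (fun l => ENNReal.log (M l))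
      (fun ω => (θ ω).toReal - (∫⁻ ω', θ ω' ∂P).toReal)) (hbt : b ≠ ⊤)
    {K : ℝ} (hK0 : 0 ≤ K) (hK : K ^ 2 = b.toReal ^ 2 + (∫⁻ ω, θ ω ∂P).toReal ^ 2)
    (hth : 2 * K * (1 + K) ≤ u * (∫⁻ ω, θ ω ∂P).toReal) :
    P {ω | (u : EReal) < ⨆ x, (ξ x ω : EReal)} ≤
      ⨅ (δ : ℝ) (_ : 0 < δ) (_ : ENNReal.ofReal δ < diamOf ζ),
        (coverNumber ζ δ : ℝ≥0∞) * (expDual M (u / (1 + K * δ)))⁻¹ := by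
  refine le_iInf fun δ => le_iInf fun hδ => le_iInf fun hδD => ?_
  have hδ1 : δ < 1 := ENNReal.ofReal_lt_one.1
    (hδD.trans_le (iSup_le fun x => iSup_le fun y => hζ x y))
  refine measure_lt_iSup_le hδ hS hsep hinc (ae_lt_top hθ hθe) fun x => ?_
  set e := (∫⁻ ω, θ ω ∂P).toReal with he
  have hmono : ∀ v, u / (1 + K * δ) ≤ v → (expDual M v)⁻¹ ≤ (expDual M (u / (1 + K * δ)))⁻¹ :=
    fun v hv => ENNReal.inv_le_inv.2 (hM.expDual_mono (by positivity) hv)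
  -- When Eθ = 0 there is no strict gap between K and ‖θ - Eθ‖, but then θ = 0 and Chernoff's bound
  -- for ξ(x) alone suffices.
  rcases (ENNReal.toReal_nonneg : 0 ≤ e).eq_or_lt with he0 | he0
  · have hθ0 : θ =ᵐ[P] 0 := by
      refine (lintegral_eq_zero_iff hθ).1 ?_
      rcases (ENNReal.toReal_eq_zero_iff _).1 he0.symm with h | h
      · exact h
      · exact absurd h hθe
    have hsub : {ω | u < ξ x ω + δ * (θ ω).toReal} ≤ᵐ[P] {ω | u ≤ ξ x ω} := by
      filter_upwards [hθ0] with ω hω h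
      have h' : u < ξ x ω + δ * (θ ω).toReal := h
      rw [hω, Pi.zero_apply, ENNReal.toReal_zero, mul_zero, add_zero] at h'
      exact h'.le
    refine (measure_mono_ae hsub).trans ((hM.measure_le_inv_expDual (c := 1)
      (hξ x).aemeasurable one_pos hu.le fun l => ?_).trans (hmono _ ?_))
    · rw [mul_one]; exact hmom x l
    · exact div_le_div_of_nonneg_left hu.le one_pos (by linarith [mul_nonneg hK0 hδ.le])
  · have hlt := lt_sub_div_of_threshold ENNReal.toReal_nonneg he0 hK0 hK hu hth hδ1
    -- The strict inequality provides an admissible τ without the infimum in the norm being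
    -- attained.
    have hlt' : b < ENNReal.ofReal (K - e * (1 + K * δ) / u) := by
      rw [← ENNReal.ofReal_toReal hbt]
      exact (ENNReal.ofReal_lt_ofReal_iff_of_nonneg ENNReal.toReal_nonneg).2 hlt
    rw [hb] at hlt'
    obtain ⟨τ, hτ0, hτ, hη⟩ := exists_of_bNorm_lt hlt'
    have hle := div_le_div_of_lt_sub_div hK0 hu hδ hτ0 hτ
    have hc : 0 < 1 + δ * τ := by positivity
    have hv : 0 ≤ u - δ * e := by
      by_contra! h
      have h1 := div_neg_of_neg_of_pos h hc
      have h2 : 0 < u / (1 + K * δ) := by positivity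
      linarith
    have hηm : AEMeasurable (fun ω => (θ ω).toReal - e) P :=
      (hθ.ennreal_toReal.sub_const e).aemeasurable
    refine le_trans (measure_mono fun ω hω => ?_)
      ((hM.measure_le_inv_expDual (W := fun ω => ξ x ω + δ * ((θ ω).toReal - e))
        ((hξ x).aemeasurable.add (hηm.const_mul δ)) hc hv
        (IsMoment.lintegral_eexp_add_le (hξ x).aemeasurable hηm hδ hτ0 (hmom x) hη)).trans (hmono _ hle))
    have hω' : u < ξ x ω + δ * (θ ω).toReal := hω
    change u - δ * e ≤ ξ x ω + δ * ((θ ω).toReal - e)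
    linarith

end Main

end RandomFieldSup

theorem mainTheorem10
    {X : Type*} [PseudoMetricSpace X] [CompactSpace X] [MeasurableSpace X] [BorelSpace X]
    {Ω : Type*} [MeasurableSpace Ω] (P : Measure Ω) [IsProbabilityMeasure P]
    (m : Measure X) [IsProbabilityMeasure m]
    (ξ : X → Ω → ℝ)
    (hmeas : Measurable (Function.uncurry ξ))
    (hsep : RandomFieldSup.IsSeparableField P ξ)
    (hcont : ∀ x : X, TendstoInMeasure P ξ (𝓝 x) (ξ x))
    (hcentred : ∀ x : X, Integrable (ξ x) P ∧ ∫ ω, ξ x ω ∂P = 0)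
    (hcramer : RandomFieldSup.UniformCramer P ξ)
    (heven : ∀ lam : ℝ,
      RandomFieldSup.naturalFunction P ξ (-lam) = RandomFieldSup.naturalFunction P ξ lam)
    (hminor : ∀ (x₁ x₂ : X) (V : ℝ≥0∞), V ≠ ⊤ → RandomFieldSup.fieldWBar P m ξ x₁ x₂ V < ⊤) :
    RandomFieldSup.fieldK P m ξ < ⊤ ∧
    RandomFieldSup.fieldThreshold P m ξ < ⊤ ∧
    ∀ u : ℝ, 2 ≤ u → RandomFieldSup.fieldThreshold P m ξ ≤ ENNReal.ofReal u →
      P {ω | (u : EReal) < ⨆ x : X, (ξ x ω : EReal)}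
          ≤ RandomFieldSup.entropyBound P m ξ u ∧
      P {ω | (u : EReal) < ⨆ x : X, ((|ξ x ω| : ℝ) : EReal)}
          ≤ 2 * RandomFieldSup.entropyBound P m ξ u := by
  open RandomFieldSup in
  have : Nonempty X := nonempty_of_isProbabilityMeasure m
  have hξ : ∀ x, Measurable (ξ x) := fun x => hmeas.of_uncurry_left
  have hM : IsMoment (momentSup P ξ) := isMoment_momentSup hξ hcentred hcramer heven
  set M := momentSup P ξ with hMdef
  have hΦ : fieldPhi P ξ = dualOrlicz M := youngOrlicz_log M
  set d := natDist P (dualOrlicz M) ξ with hd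
  have hfd : fieldDist P ξ = d := by rw [fieldDist, hΦ]
  have hw : ∀ x y, wBar m d (dualOrlicz M) x y 1 < ⊤ := fun x y => by
    have := hminor x y 1 ENNReal.one_ne_top
    rwa [fieldWBar, hΦ, hfd] at this
  have hdeg : (∀ x, ξ x =ᵐ[P] 0) → ∀ x y, d x y = 0 := fun h x y =>
    natDist_eq_zero_of_ae_eq hM ((h x).trans (h y).symm)
  have hsymm : ∀ x y, d x y = d y x := natDist_comm _
  have htri : ∀ x y z, d x z ≤ d x y + d y z := natDist_triangle hM hξ
  have hball := measurableSet_natDist_ball (P := P) hM hmeas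
  have hfin : ∀ x y, d x y ≠ ⊤ := fun x y => by
    by_cases h0 : ∀ x, ξ x =ᵐ[P] 0
    · rw [hdeg h0]; exact ENNReal.zero_ne_top
    push Not at h0
    obtain ⟨x₀, hx₀⟩ := h0
    obtain ⟨σ, hσ, hMσ⟩ := exists_one_add_sq_le_momentSup hξ heven hx₀
    -- The bound M(1) ≥ 1 + σ supplies the slope log(1 + σ) at l₀ = 1.
    refine ne_top_of_wBar_lt_top (hM.orliczInv_four_pos (a := Real.log (1 + σ)) (l₀ := 1)
      (Real.log_pos (by linarith)) one_pos ?_) (hw x y)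
    have h1 := hMσ 1
    rw [one_pow, mul_one] at h1
    rwa [mul_one, eexp, Real.exp_log (by linarith)]
  have hmin : ∀ r, 0 < r → minBall m d r ≠ 0 := fun r hr => minBall_ne_zero hfin hw hr
  have hdiam : diamOf d < ⊤ := diamOf_lt_top hball hfin hsymm htri (hmin 1 one_pos)
  have hγ := gammaSup_one_lt_top hM hfin hmin hw hdiam
  set Z := zVar m d (dualOrlicz M) ξ with hZ
  have hZm : Measurable Z := measurable_zVar hM hmeas
  have hEZ : ∫⁻ ω, Z ω ∂P ≤ 1 := lintegral_zVar_le hM hmeas hfin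
  set θ : Ω → ℝ≥0∞ := fun ω => gammaSup m d (dualOrlicz M) (Z ω) with hθ
  have hfθ : fieldTheta P m ξ = θ := by funext ω; rw [fieldTheta, hΦ, hfd]
  have hθm : Measurable θ := gammaSup_mono.measurable.comp hZm
  obtain ⟨hEθ, hτ⟩ := exists_bound_gammaSup hM hfin hdiam hγ hZm hEZ
  set ζ := zeta m d (dualOrlicz M) with hζ
  have hfζ : fieldZeta P m ξ = ζ := by rw [fieldZeta, hΦ, hfd]
  have hinc : ∀ x y, ∀ᵐ ω ∂P, ENNReal.ofReal |ξ x ω - ξ y ω| ≤ ζ x y * θ ω := fun x y => by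
    filter_upwards [ae_ofReal_abs_sub_le_wBar hM hmeas hfin hmin x y,
      ae_lt_top hZm (hEZ.trans_lt ENNReal.one_lt_top).ne] with ω h1 h2
    exact h1.trans (wBar_le_zeta_mul_gammaSup hM x y h2.ne
      (gammaSup_lt_top hM hfin hdiam hγ h2.ne).ne)
  set E := ∫⁻ ω, θ ω ∂P with hE
  set b := bNorm P (fun l => ENNReal.log (M l)) (fun ω => (θ ω).toReal - E.toReal) with hb
  have hb0 : E = 0 → b = 0 := fun h => by
    refine bNorm_eq_zero_of_ae_eq_zero hM ?_
    filter_upwards [(lintegral_eq_zero_iff hθm).1 h] with ω hω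
    simp [hω, h]
  have hbt : b ≠ ⊤ := by
    by_cases h0 : ∀ x, ξ x =ᵐ[P] 0
    · have : E = 0 := by simp [hE, hθ, gammaSup, wBar, hdeg h0]
      rw [hb0 this]; exact ENNReal.zero_ne_top
    push Not at h0
    obtain ⟨x₀, hx₀⟩ := h0
    obtain ⟨σ, hσ, hMσ⟩ := exists_one_add_sq_le_momentSup hξ heven hx₀
    obtain ⟨τ, hτ0, hle⟩ := hτ σ hσ hMσ
    exact ((bNorm_le hτ0 hle).trans_lt ENNReal.ofReal_lt_top).ne
  have hKeq : fieldK P m ξ = (b ^ 2 + E ^ 2) ^ (1 / 2 : ℝ) := by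
    rw [fieldK, bNormNonneg, hfθ, naturalFunction_eq_log]
  have hsum : b ^ 2 + E ^ 2 ≠ ⊤ := by finiteness
  have hKt : fieldK P m ξ < ⊤ := by
    rw [hKeq]
    exact ENNReal.rpow_lt_top_of_nonneg (by norm_num) hsum
  have hK2 : (fieldK P m ξ).toReal ^ 2 = b.toReal ^ 2 + E.toReal ^ 2 := by
    rw [hKeq, ← ENNReal.toReal_pow, ← ENNReal.rpow_natCast, ← ENNReal.rpow_mul]
    norm_num
    rw [ENNReal.toReal_add (by finiteness) (by finiteness), ENNReal.toReal_pow,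
      ENNReal.toReal_pow]
  have hTeq : fieldThreshold P m ξ = 2 * fieldK P m ξ * (1 + fieldK P m ξ) / E := by
    rw [fieldThreshold, hfθ]
  have hK0 : E = 0 → fieldK P m ξ = 0 := fun h => by
    rw [hKeq, hb0 h, h]; simp
  refine ⟨hKt, ?_, fun u hu hthr => ?_⟩
  · rw [hTeq]
    rcases eq_or_ne E 0 with h | h
    · rw [hK0 h]; simp
    · exact ENNReal.div_lt_top (by finiteness) h
  have hu0 : 0 < u := by linarith
  have hth : 2 * (fieldK P m ξ).toReal * (1 + (fieldK P m ξ).toReal) ≤ u * E.toReal := by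
    rcases eq_or_ne E 0 with h | h
    · rw [hK0 h, h]; simp
    rw [hTeq, ENNReal.div_le_iff_le_mul (Or.inl h) (Or.inl hEθ.ne)] at hthr
    have := ENNReal.toReal_mono (by finiteness) hthr
    rwa [ENNReal.toReal_mul, ENNReal.toReal_mul, ENNReal.toReal_mul,
      ENNReal.toReal_add ENNReal.one_ne_top hKt.ne, ENNReal.toReal_one,
      ENNReal.toReal_ofReal hu0.le, ENNReal.toReal_ofNat] at this
  have hbound : entropyBound P m ξ u = ⨅ (δ : ℝ) (_ : 0 < δ) (_ : ENNReal.ofReal δ < diamOf ζ),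
      (coverNumber ζ δ : ℝ≥0∞) * (expDual M (u / (1 + (fieldK P m ξ).toReal * δ)))⁻¹ := by
    simp only [entropyBound, hfζ, EReal.exp_neg, naturalFunction_eq_log, exp_youngFenchel_log]
    rfl
  obtain ⟨S, hS, hsepS⟩ := hsep.exists_countable
  have hpos : P {ω | (u : EReal) < ⨆ x : X, (ξ x ω : EReal)} ≤ entropyBound P m ξ u := by
    rw [hbound]
    exact measure_lt_iSup_le_entropy hM hξ (fun x l => lintegral_eexp_le_momentSup x l)
      (zeta_le_one _) hθm hEθ.ne hinc hu0 hS (hsepS (fun t => t) continuous_id u) hb hbt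
      ENNReal.toReal_nonneg hK2 hth
  -- The field -ξ has the same absolute increments and, φ being even, the same moment bound, so ζ, θ
  -- and K carry over unchanged.
  have hneg : P {ω | (u : EReal) < ⨆ x : X, ((-ξ x ω : ℝ) : EReal)} ≤ entropyBound P m ξ u := by
    rw [hbound]
    refine measure_lt_iSup_le_entropy (ξ := fun x ω => -ξ x ω) hM (fun x => (hξ x).neg)
      (fun x l => ?_) (zeta_le_one _) hθm hEθ.ne (fun x y => ?_) hu0 hS
      (hsepS (fun t => -t) continuous_neg u) hb hbt ENNReal.toReal_nonneg hK2 hth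
    · rw [← hM.even l]
      simp only [mul_neg, ← neg_mul]
      exact lintegral_eexp_le_momentSup x (-l)
    · filter_upwards [hinc x y] with ω hω
      rwa [neg_sub_neg, abs_sub_comm]
  refine ⟨hpos, ?_⟩
  calc P {ω | (u : EReal) < ⨆ x : X, ((|ξ x ω| : ℝ) : EReal)}
      ≤ P ({ω | (u : EReal) < ⨆ x : X, (ξ x ω : EReal)}
          ∪ {ω | (u : EReal) < ⨆ x : X, ((-ξ x ω : ℝ) : EReal)}) := by
        refine measure_mono fun ω hω => ?_
        have hω' : (u : EReal) < ⨆ x : X, ((|ξ x ω| : ℝ) : EReal) := hω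
        obtain ⟨x, hx⟩ := lt_iSup_iff.1 hω'
        rcases abs_choice (ξ x ω) with h | h <;> rw [h] at hx
        · exact Or.inl (hx.trans_le (le_iSup (fun x => (ξ x ω : EReal)) x))
        · exact Or.inr (hx.trans_le (le_iSup (fun x => ((-ξ x ω : ℝ) : EReal)) x))
    _ ≤ _ := (measure_union_le _ _).trans ((add_le_add hpos hneg).trans (two_mul _).ge)
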